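/- **Setting.** Let $A$ be a finite alphabet. A class (set of languages over $A$) is a *quotienting Boolean algebra* if it contains $\emptyset$ and $A^*$ and is closed under union, intersection, complement and the quotients $L\mapsto\{u: wu\in L\}$, $L\mapsto\{u: uw\in L\}$ for $w\in A^*$. For a class $\mathcal C$, $\mathrm{Bool}(\mathcal C)$ is the least Boolean algebra containing $\mathcal C$; $\mathrm{Pol}(\mathcal C)$ is the least class containing $\mathcal C$ and closed under union and under $(K,L)\mapsto KaL$ for $a\in A$; and $\mathrm{PBPol}(\mathcal C)=\mathrm{Pol}(\mathrm{Bool}(\mathrm{Pol}(\mathcal C)))$. Fix a finite quotienting Boolean algebra $\mathcal C$. Write $w\sim_{\mathcal C}w'$ if $w$ and $w'$ belong to the same languages of $\mathcal C$, and $[w]_{\mathcal C}$ for the $\sim_{\mathcal C}$-class of $w$. A *hemiring* is a set with a commutative monoid addition (neutral element $0$) and an associative multiplication that distributes over addition and for which $0$ is absorbing. It is *idempotent* if $r+r=r$ for all $r$; then $r\le s$ means $s+r=s$. A *multiplicative rating map* is a hemiring morphism $\rho:2^{A^*}\to R$ (with union and concatenation on $2^{A^*}$) into a finite idempotent hemiring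 $R$; write $\rho(w)=\rho(\{w\})$. It is *nice* if for every $K\subseteq A^*$ there are finitely many $w_1,\dots,w_n\in K$ with $\rho(K)=\rho(w_1)+\cdots+\rho(w_n)$. It is *$\mathcal C$-compatible* if to each $r\in R$ one can assign a $\sim_{\mathcal C}$-class $[r]_{\mathcal C}$ such that $w\in[r]_{\mathcal C}$ whenever $\rho(w)=r$. A monoid morphism $\alpha:A^*\to M$ into a finite monoid is *$\mathcal C$-compatible* if to each $s\in M$ one can assign a $\sim_{\mathcal C}$-class $[s]_{\mathcal C}$ with $\alpha^{-1}(s)\subseteq[s]_{\mathcal C}$. For compatible $\alpha,\rho$, arbitrary such assignments are fixed. For a class $\mathcal D$, a *$\mathcal D$-cover* of $L\subseteq A^*$ is a finite set $\mathbf K\subseteq\mathcal D$ with $L\subseteq\bigcup_{K\in\mathbf K}K$. Its *$\rho$-imprint* is $\{r\in R:\exists K\in\mathbf K,\ r\le\rho(K)\}$. A $\mathcal D$-cover of $L$ is *optimal* if its $\rho$-imprint is contained in that of every $\mathcal D$-cover of $L$. The *$\mathcal D$-optimal $\rho$-imprint* $\mathcal I_{\mathcal D}[L,\rho]$ on $L$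 is the $\rho$-imprint of any optimal $\mathcal D$-cover of $L$, and the *$\mathcal D$-optimal $\alpha$-pointed $\rho$-imprint* is $\mathcal P_{\mathcal D}[\alpha,\rho]=\{(s,r)\in M\times R: r\in\mathcal I_{\mathcal D}[\alpha^{-1}(s),\rho]\}$. For $T_1,T_2\subseteq M\times R$ put $T_1\cdot T_2=\{(s_1s_2,r):(s_1,r_1)\in T_1,\ (s_2,r_2)\in T_2,\ r\le r_1r_2\}$. A pair $(S,\mathcal T)$ with $S\subseteq M\times R$ and $\mathcal T\subseteq R\times 2^{M\times R}$ is *$\mathrm{PBPol}(\mathcal C)$-saturated* if: - $S$ contains $S_0=\{(\alpha(w),r): w\in A^*,\ r\le\rho(w)\}$; - (1) if $(s,r)\in S$ and $r'\le r$, then $(s,r')\in S$; - (2) if $(s_1,r_1),(s_2,r_2)\in S$, then $(s_1s_2,r_1r_2)\in S$; - (3) if $(r,T)\in\mathcal T$ and $(e,f)\in T$ with $ee=e$ and $ff=f$, then $(e,\,f\cdot(r+\rho(\varepsilon))\cdot f)\in S$; - $\mathcal T$ contains $\mathcal T_0=\{(\rho(w),\{(\alpha(w),r'): r'\le\rho(w)\}):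 w\in A^*\}$; - (4) if $(r,T)\in\mathcal T$ and $T'\subseteq T$, then $(r,T')\in\mathcal T$; - (5) if $(r_1,T_1),(r_2,T_2)\in\mathcal T$, then $(r_1r_2,T_1\cdot T_2)\in\mathcal T$; - (6) if $(f,E)\in\mathcal T$ with $ff=f$ and $E\cdot E=E$, then $(f,E\cdot T\cdot E)\in\mathcal T$ where $T=\{(s,r)\in S:[f]_{\mathcal C}=[s]_{\mathcal C}\}$. A subset $S\subseteq M\times R$ is *$\mathrm{PBPol}(\mathcal C)$-saturated* if $(S,\mathcal T)$ is $\mathrm{PBPol}(\mathcal C)$-saturated for some $\mathcal T\subseteq R\times2^{M\times R}$. **Theorem.** Let $\mathcal C$ be a finite quotienting Boolean algebra, $\alpha:A^*\to M$ a $\mathcal C$-compatible morphism into a finite monoid and $\rho:2^{A^*}\to R$ a nice $\mathcal C$-compatible multiplicative rating map. Then $\mathcal P_{\mathrm{PBPol}(\mathcal C)}[\alpha,\rho]$ is the least (for inclusion) $\mathrm{PBPol}(\mathcal C)$-saturated subset of $M\times R$. Moreover it is computed by a least fixpoint procedure: starting from the pair $(S_0,\mathcal T_0)$ and adding, in each round,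 all elements produced from the current pair by one application of one of the operations (1)–(6), one reaches after finitely many rounds the least $\mathrm{PBPol}(\mathcal C)$-saturated pair (for componentwise inclusion), and its first component is $\mathcal P_{\mathrm{PBPol}(\mathcal C)}[\alpha,\rho]$. -/

import Mathlib

namespace PBPol

universe u v w

/-! ### Classes of languages -/

/-- A Boolean algebra of languages over `A` that is closed under left and right quotients by words. -/
structure IsQuotientingBooleanAlgebra {A : Type u} (C : Set (Language A)) : Prop where
  bot_mem : ⊥ ∈ C
  top_mem : ⊤ ∈ C
  sup_mem : ∀ K ∈ C, ∀ L ∈ C, K ⊔ L ∈ C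
  inf_mem : ∀ K ∈ C, ∀ L ∈ C, K ⊓ L ∈ C
  compl_mem : ∀ L ∈ C, Lᶜ ∈ C
  leftQuotient_mem : ∀ L ∈ C, ∀ x : List A, ({y | x ++ y ∈ L} : Language A) ∈ C
  rightQuotient_mem : ∀ L ∈ C, ∀ x : List A, ({y | y ++ x ∈ L} : Language A) ∈ C

/-- `Bool(C)`: the least Boolean algebra of languages containing `C`. -/
inductive BoolClosure {A : Type u} (C : Set (Language A)) : Set (Language A)
  | base {L : Language A} : L ∈ C → BoolClosure C L
  | bot : BoolClosure C ⊥
  | top : BoolClosure C ⊤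
  | sup {K L : Language A} : BoolClosure C K → BoolClosure C L → BoolClosure C (K ⊔ L)
  | inf {K L : Language A} : BoolClosure C K → BoolClosure C L → BoolClosure C (K ⊓ L)
  | compl {L : Language A} : BoolClosure C L → BoolClosure C Lᶜ

/-- `Pol(C)`: the least class containing `C` and closed under union and under the marked
concatenations `K a L`, for `a` a letter. -/
inductive PolClosure {A : Type u} (C : Set (Language A)) : Set (Language A)
  | base {L : Language A} : L ∈ C → PolClosure C L
  | sup {K L : Language A} : PolClosure C K → PolClosure C L → PolClosure C (K ⊔ L)
  | marked {K L : Language A} (a : A) :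
      PolClosure C K → PolClosure C L → PolClosure C (K * {[a]} * L)

/-- `PBPol(C) = Pol(Bool(Pol(C)))`. -/
def PBPolClosure {A : Type u} (C : Set (Language A)) : Set (Language A) :=
  PolClosure (BoolClosure (PolClosure C))

/-- The canonical equivalence `∼_C` on words: membership in the same languages of `C`. -/
def canonicalSetoid {A : Type u} (C : Set (Language A)) : Setoid (List A) where
  r x y := ∀ L ∈ C, x ∈ L ↔ y ∈ L
  iseqv :=
    ⟨fun _ _ _ => Iff.rfl, fun h L hL => (h L hL).symm,
      fun h h' L hL => (h L hL).trans (h' L hL)⟩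

/-- The set of `∼_C`-classes. -/
def CType {A : Type u} (C : Set (Language A)) : Type u := Quotient (canonicalSetoid C)

/-- The `∼_C`-class `[x]_C` of a word `x`. -/
def ctype {A : Type u} (C : Set (Language A)) (x : List A) : CType C :=
  Quotient.mk (canonicalSetoid C) x

/-! ### Rating maps

A hemiring is a `NonUnitalSemiring`; a multiplicative rating map is a morphism of hemirings
`Language A →ₙ+* R` into a finite hemiring with idempotent addition. -/

/-- The canonical order of an idempotent hemiring: `r ≤ s` when `s + r = s`. -/
def HLe {R : Type w} [Add R] (r s : R) : Prop := s + r = s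

/-- `ρ` is nice: the image of any language is a finite sum of images of its words. -/
def IsNice {A : Type u} {R : Type w} [NonUnitalSemiring R] (ρ : Language A →ₙ+* R) : Prop :=
  ∀ K : Language A, ∃ l : List (List A),
    (∀ x ∈ l, x ∈ K) ∧ ρ K = (l.map fun x => ρ {x}).sum

/-- The language `α⁻¹(s)`. -/
def fiber {A : Type u} {M : Type v} [Monoid M] (α : FreeMonoid A →* M) (s : M) : Language A :=
  {x | α (FreeMonoid.ofList x) = s}

/-- The map `s ↦ [s]_C` satisfies `α⁻¹(s) ⊆ [s]_C` for all `s`. The morphism `α` is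
`C`-compatible when such a map exists; the map is then regarded as fixed together with `α`
(its value at `s` is arbitrary when `α⁻¹(s)` is empty). -/
def IsMorphismTypeMap {A : Type u} {M : Type v} [Monoid M] (C : Set (Language A))
    (α : FreeMonoid A →* M) (tM : M → CType C) : Prop :=
  ∀ s : M, ∀ x ∈ fiber α s, ctype C x = tM s

/-- The map `r ↦ [r]_C` satisfies `x ∈ [r]_C` whenever `ρ({x}) = r`. The rating map `ρ` is
`C`-compatible when such a map exists; the map is then regarded as fixed together with `ρ`. -/
def IsRatingTypeMap {A : Type u} {R : Type w} [NonUnitalSemiring R] (C : Set (Language A))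
    (ρ : Language A →ₙ+* R) (tR : R → CType C) : Prop :=
  ∀ r : R, ∀ x : List A, ρ {x} = r → ctype C x = tR r

/-! ### Imprints and optimal covers -/

/-- `𝒦` is a `D`-cover of `L`: a finite set of languages of `D` whose union contains `L`. -/
def IsCover {A : Type u} (D : Set (Language A)) (L : Language A) (𝒦 : Set (Language A)) : Prop :=
  𝒦.Finite ∧ 𝒦 ⊆ D ∧ ∀ x ∈ L, ∃ K ∈ 𝒦, x ∈ K

/-- The `ρ`-imprint of a set of languages. -/
def imprint {A : Type u} {R : Type w} [NonUnitalSemiring R] (ρ : Language A →ₙ+* R)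
    (𝒦 : Set (Language A)) : Set R :=
  {r | ∃ K ∈ 𝒦, HLe r (ρ K)}

/-- `𝒦` is an optimal `D`-cover of `L` for `ρ`: it has the least `ρ`-imprint. -/
def IsOptimalCover {A : Type u} {R : Type w} [NonUnitalSemiring R] (D : Set (Language A))
    (ρ : Language A →ₙ+* R) (L : Language A) (𝒦 : Set (Language A)) : Prop :=
  IsCover D L 𝒦 ∧ ∀ 𝒦', IsCover D L 𝒦' → imprint ρ 𝒦 ⊆ imprint ρ 𝒦'

/-- The `D`-optimal `ρ`-imprint on `L`: the `ρ`-imprint common to all optimal `D`-covers of `L`. -/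
def optImprint {A : Type u} {R : Type w} [NonUnitalSemiring R] (D : Set (Language A))
    (ρ : Language A →ₙ+* R) (L : Language A) : Set R :=
  {r | ∃ 𝒦, IsOptimalCover D ρ L 𝒦 ∧ r ∈ imprint ρ 𝒦}

/-- The `D`-optimal `α`-pointed `ρ`-imprint. -/
def pointedOptImprint {A : Type u} {M : Type v} {R : Type w} [Monoid M] [NonUnitalSemiring R]
    (D : Set (Language A)) (α : FreeMonoid A →* M) (ρ : Language A →ₙ+* R) : Set (M × R) :=
  {p | p.2 ∈ optImprint D ρ (fiber α p.1)}

/-! ### Saturation -/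

/-- The trivial elements `(α(x), r)` with `r ≤ ρ(x)`. -/
def trivialImprint {A : Type u} {M : Type v} {R : Type w} [Monoid M] [NonUnitalSemiring R]
    (α : FreeMonoid A →* M) (ρ : Language A →ₙ+* R) : Set (M × R) :=
  {p | ∃ x : List A, p.1 = α (FreeMonoid.ofList x) ∧ HLe p.2 (ρ {x})}

/-- The pairs `(ρ(x), {(α(x), r') | r' ≤ ρ(x)})`, for `x` a word. -/
def trivialNested {A : Type u} {M : Type v} {R : Type w} [Monoid M] [NonUnitalSemiring R]
    (α : FreeMonoid A →* M) (ρ : Language A →ₙ+* R) : Set (R × Set (M × R)) :=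
  {q | ∃ x : List A,
    q = (ρ {x}, {p | p.1 = α (FreeMonoid.ofList x) ∧ HLe p.2 (ρ {x})})}

/-- The multiplication of subsets of `M × R`, closed under downset by definition. -/
def dmul {M : Type v} {R : Type w} [Monoid M] [NonUnitalSemiring R] (T₁ T₂ : Set (M × R)) :
    Set (M × R) :=
  {p | ∃ p₁ ∈ T₁, ∃ p₂ ∈ T₂, p.1 = p₁.1 * p₂.1 ∧ HLe p.2 (p₁.2 * p₂.2)}

/-- The elements of `S` whose first component has type `c`. -/
def restrictType {A : Type u} {M : Type v} {R : Type w} {C : Set (Language A)}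
    (tM : M → CType C) (S : Set (M × R)) (c : CType C) : Set (M × R) :=
  {p | p ∈ S ∧ c = tM p.1}

/-- The pair `(S, 𝒯)`, with `S ⊆ M × R` and `𝒯 ⊆ R × 2^(M × R)`, is `PBPol(C)`-saturated
for `α` and `ρ`. -/
structure IsSaturatedPair {A : Type u} {M : Type v} {R : Type w} [Monoid M] [NonUnitalSemiring R]
    {C : Set (Language A)} (α : FreeMonoid A →* M) (tM : M → CType C)
    (ρ : Language A →ₙ+* R) (tR : R → CType C)
    (S : Set (M × R)) (𝒯 : Set (R × Set (M × R))) : Prop where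
  trivial_subset : trivialImprint α ρ ⊆ S
  downset : ∀ s r r', (s, r) ∈ S → HLe r' r → (s, r') ∈ S
  mul : ∀ s₁ r₁ s₂ r₂, (s₁, r₁) ∈ S → (s₂, r₂) ∈ S → (s₁ * s₂, r₁ * r₂) ∈ S
  pbpol_closure : ∀ r T e f, (r, T) ∈ 𝒯 → (e, f) ∈ T → e * e = e → f * f = f →
    (e, f * (r + ρ {[]}) * f) ∈ S
  nested_trivial_subset : trivialNested α ρ ⊆ 𝒯
  nested_downset : ∀ r T T', (r, T) ∈ 𝒯 → T' ⊆ T → (r, T') ∈ 𝒯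
  nested_mul : ∀ r₁ T₁ r₂ T₂, (r₁, T₁) ∈ 𝒯 → (r₂, T₂) ∈ 𝒯 → (r₁ * r₂, dmul T₁ T₂) ∈ 𝒯
  nested_closure : ∀ f E, (f, E) ∈ 𝒯 → f * f = f → dmul E E = E →
    (f, dmul (dmul E (restrictType tM S (tR f))) E) ∈ 𝒯

/-- `S ⊆ M × R` is `PBPol(C)`-saturated for `α` and `ρ`. -/
def IsSaturated {A : Type u} {M : Type v} {R : Type w} [Monoid M] [NonUnitalSemiring R]
    {C : Set (Language A)} (α : FreeMonoid A →* M) (tM : M → CType C)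
    (ρ : Language A →ₙ+* R) (tR : R → CType C) (S : Set (M × R)) : Prop :=
  ∃ 𝒯 : Set (R × Set (M × R)), IsSaturatedPair α tM ρ tR S 𝒯

/-! ### The least fixpoint procedure -/

/-- One round of the procedure: add to both components of a pair everything that one application
of one of the six operations produces. -/
def saturationStep {A : Type u} {M : Type v} {R : Type w} [Monoid M] [NonUnitalSemiring R]
    {C : Set (Language A)} (tM : M → CType C) (ρ : Language A →ₙ+* R) (tR : R → CType C)
    (P : Set (M × R) × Set (R × Set (M × R))) : Set (M × R) × Set (R × Set (M × R)) :=
  (P.1 ∪ {p | ∃ r, (p.1, r) ∈ P.1 ∧ HLe p.2 r}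
      ∪ {p | ∃ p₁ ∈ P.1, ∃ p₂ ∈ P.1, p = (p₁.1 * p₂.1, p₁.2 * p₂.2)}
      ∪ {p | ∃ q ∈ P.2, ∃ e f, (e, f) ∈ q.2 ∧ e * e = e ∧ f * f = f ∧
          p = (e, f * (q.1 + ρ {[]}) * f)},
    P.2 ∪ {q | ∃ T, (q.1, T) ∈ P.2 ∧ q.2 ⊆ T}
      ∪ {q | ∃ q₁ ∈ P.2, ∃ q₂ ∈ P.2, q = (q₁.1 * q₂.1, dmul q₁.2 q₂.2)}
      ∪ {q | ∃ f E, (f, E) ∈ P.2 ∧ f * f = f ∧ dmul E E = E ∧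
          q = (f, dmul (dmul E (restrictType tM P.1 (tR f))) E)})

/-- The pair obtained after `n` rounds, starting from the trivial elements. -/
def saturationIterate {A : Type u} {M : Type v} {R : Type w} [Monoid M] [NonUnitalSemiring R]
    {C : Set (Language A)} (α : FreeMonoid A →* M) (tM : M → CType C)
    (ρ : Language A →ₙ+* R) (tR : R → CType C) (n : ℕ) :
    Set (M × R) × Set (R × Set (M × R)) :=
  (saturationStep tM ρ tR)^[n] (trivialImprint α ρ, trivialNested α ρ)

end PBPol

/-! Write c for ∼_C. In `pre c (n+1)`, every marked letter of x must be matched in y with both sides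
going up at level n, so upsets of `pre c` describe Pol(C). Its symmetric part `eqv c j` describes
Bool(Pol(C)), and j rounds over `eqv c j` give `fine c j`, which describes PBPol(C). Each level has
finitely many principal upsets `fineUp c j x`, all in PBPol(C), and every language of PBPol(C) is an
upset of some level. Hence the optimal pointed imprint is `tau`: the pairs (s, r) such that at every
level j some x with α(x) = s has r ≤ ρ(fineUp c j x) (`pointedOptImprint_eq_tau`).

Soundness (`isSaturatedPair_tau`) pairs `tau` with the (r, T) such that for every k some x with ρ(x)
= r has T contained in the `tau` of the words above x at level k. Operations (3) and (6) are
pumping: if x is idempotent for a congruence and y is equivalent to x, large powers of x lie below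
x^i y x^l in every level over that congruence (`exists_pump`). Operation (6) pumps over c; operation
(3) pumps over c, then over `eqv c j`.

Completeness needs, for a given saturated pair (S, 𝒯), one level that works for all words at once.
This uniformity replaces an induction on bounded-height factorizations: by `ratClosed_top`, a
property of languages stable under sublanguages, union and product holds for all words as soon as it
passes to the star of languages inside one idempotent class of a finite congruence. The star case
uses `ratClosed_top_of_bracket`: long lists over a finite semigroup may be assumed to begin and end
with blocks of the same idempotent value, which is the shape that operations (6) and (3) require.

The nested half (`exists_isNestedLevel`) is proved first, relative to any factor-closed F whose
`tau` is already in S, with a level k independent of F. The pointed half then uses the congruence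
given by α and `eqv c k`, applying the nested half to the factors of finite powers of the language
under the star. Niceness turns the images of single words into the image of a whole class. -/

namespace PBPol

universe u v w

open Computability

/-! ### Restricted rational expressions

Every language recognized by a finite congruence is obtained from finite languages by union,
product, and the star restricted to languages contained in a single idempotent class. The result
is stated as an induction principle for predicates on languages. -/

/-- A predicate on languages that is closed under sublanguages, union and product, and that holds
for the empty word and for the letters. -/
structure IsRatClosed {X : Type u} (G : Language X → Prop) : Prop where
  mono : ∀ {K L : Language X}, K ≤ L → G L → G K
  one : G 1
  letter : ∀ x : X, G {[x]}
  add : ∀ {K L : Language X}, G K → G L → G (K + L)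
  mul : ∀ {K L : Language X}, G K → G L → G (K * L)

theorem IsRatClosed.of_finite_cover {X : Type u} {G : Language X → Prop} (hG : IsRatClosed G)
    {ι : Type v} [Finite ι] (f : ι → Language X) (hf : ∀ i, G (f i)) {L : Language X}
    (hL : ∀ x ∈ L, ∃ i, x ∈ f i) : G L := by
  have key : ∀ s : Set ι, s.Finite → G ({x | ∃ i ∈ s, x ∈ f i} : Language X) := by
    intro s hs
    induction s, hs using Set.Finite.induction_on with
    | empty =>
      refine hG.mono ?_ hG.one
      rintro x ⟨i, hi, -⟩
      exact hi.elim
    | @insert a s _ _ ih =>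
      refine hG.mono ?_ (hG.add (hf a) ih)
      rintro x ⟨i, rfl | hi, hx⟩
      · exact Or.inl hx
      · exact Or.inr ⟨i, hi, hx⟩
  refine hG.mono ?_ (key Set.univ Set.finite_univ)
  intro x hx
  obtain ⟨i, hi⟩ := hL x hx
  exact ⟨i, trivial, hi⟩

/-- The action of words on states that is induced by an action `δ` of letters. -/
def act {X : Type u} {Q : Type v} (δ : X → Q → Q) (x : List X) (q : Q) : Q :=
  x.foldl (fun q a => δ a q) q

@[simp] theorem act_nil {X : Type u} {Q : Type v} (δ : X → Q → Q) (q : Q) : act δ [] q = q := rfl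

@[simp] theorem act_append {X : Type u} {Q : Type v} (δ : X → Q → Q) (x y : List X) (q : Q) :
    act δ (x ++ y) q = act δ y (act δ x q) := by
  simp [act]

@[simp] theorem act_cons {X : Type u} {Q : Type v} (δ : X → Q → Q) (a : X) (y : List X) (q : Q) :
    act δ (a :: y) q = act δ y (δ a q) := rfl

/-- Closure under the star of languages all of whose words act as one idempotent. -/
def IsStarClosed {X : Type u} {Q : Type v} (δ : X → Q → Q) (G : Language X → Prop) : Prop :=
  ∀ L : Language X, G L → (∀ x ∈ L, ∀ y ∈ L, ∀ q, act δ x q = act δ y q) →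
    (∀ x ∈ L, ∀ q, act δ x (act δ x q) = act δ x q) → G (L∗)

theorem kstar_add_le {X : Type u} (K M : Language X) : (K + M)∗ ≤ K∗ * (M * K∗)∗ := by
  have h : (K + M)∗ * 1 ≤ K∗ * (M * K∗)∗ := by
    apply kstar_mul_le
    · calc (1 : Language X) = 1 * 1 := by simp
        _ ≤ _ := mul_le_mul' one_le_kstar one_le_kstar
    · rw [add_mul]
      apply add_le
      · rw [← mul_assoc]
        exact mul_le_mul' mul_kstar_le_kstar le_rfl
      · rw [← mul_assoc]
        calc M * K∗ * (M * K∗)∗ ≤ (M * K∗)∗ := mul_kstar_le_kstar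
          _ = 1 * (M * K∗)∗ := by simp
          _ ≤ _ := mul_le_mul' one_le_kstar le_rfl
  simpa using h

theorem kstar_induction {X : Type u} {L : Language X} {p : List X → Prop}
    (h0 : p []) (h1 : ∀ x ∈ L, ∀ y ∈ L∗, p y → p (x ++ y)) {z : List X} (hz : z ∈ L∗) : p z := by
  obtain ⟨l, rfl, hl⟩ := Language.mem_kstar.1 hz
  clear hz
  induction l with
  | nil => exact h0
  | cons x l ih =>
    have hl' : ∀ y ∈ l, y ∈ L := fun y hy => hl y (List.mem_cons_of_mem _ hy)
    exact h1 x (hl x List.mem_cons_self) _ (Language.join_mem_kstar hl') (ih hl')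

/-- The star of a language whose words map all states into `D`, and which act on `D` as one
idempotent. -/
theorem kstar_of_retract {X : Type u} {Q : Type v} [Finite Q] {δ : X → Q → Q}
    {G : Language X → Prop} (hG : IsRatClosed G) (hs : IsStarClosed δ G) {L : Language X}
    (hL : G L) (D : Set Q) (t : Q → Q) (h1 : ∀ x ∈ L, ∀ q, act δ x q ∈ D)
    (h2 : ∀ x ∈ L, ∀ q ∈ D, act δ x q = t q) (h3 : ∀ q ∈ D, t (t q) = t q) : G (L∗) := by
  classical
  have hfix : ∀ y ∈ L∗, ∀ q ∈ D, t q = q → act δ y q = q := by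
    intro y hy q hq htq
    refine kstar_induction (p := fun y => act δ y q = q) rfl ?_ hy
    intro x hx y _ ih
    rw [act_append, h2 x hx q hq, htq, ih]
  -- Words of L may act differently outside D, so pairs of consecutive words are sorted by the full
  -- action m of the first one, and the actions m are admitted one at a time.
  let Lm : (Q → Q) → Language X := fun m => {x | x ∈ L ∧ ∀ q, act δ x q = m q}
  let E : (Q → Q) → Language X := fun m => Lm m * L
  let U : Set (Q → Q) → Language X := fun Z => {x | ∃ m ∈ Z, x ∈ E m}
  have hEG : ∀ m, G (E m) := fun m => hG.mul (hG.mono (fun _ hx => And.left hx) hL) hL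
  have hUL : ∀ Z, U Z ≤ L∗ := by
    rintro Z x ⟨m, -, hx⟩
    obtain ⟨y, hy, z, hz, rfl⟩ := Language.mem_mul.1 hx
    have : y ++ z = [y, z].flatten := by simp
    rw [this]
    apply Language.join_mem_kstar
    intro w hw
    simp only [List.mem_cons, List.not_mem_nil, or_false] at hw
    rcases hw with rfl | rfl
    · exact hy.1
    · exact hz
  have hU : ∀ Z : Set (Q → Q), Z.Finite → G ((U Z)∗) := by
    intro Z hZ
    induction Z, hZ using Set.Finite.induction_on with
    | empty =>
      refine hG.mono ?_ hG.one
      intro x hx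
      refine kstar_induction (p := fun x => x ∈ (1 : Language X)) rfl ?_ hx
      rintro y ⟨m, hm, -⟩
      exact hm.elim
    | @insert m Z _ _ ih =>
      -- The second word of the pair brings the state to a fixed point of t in D, and all later
      -- words of L∗ then leave it in place. So the action is t ∘ m, which is idempotent because m
      -- agrees with t on D.
      have hact : ∀ x ∈ E m * (U Z)∗, ∀ q, act δ x q = t (m q) ∧ t (m q) ∈ D ∧ m q ∈ D := by
        intro x hx q
        obtain ⟨y, hy, z, hz, rfl⟩ := Language.mem_mul.1 hx
        obtain ⟨y₁, hy₁, y₂, hy₂, rfl⟩ := Language.mem_mul.1 hy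
        have hm : m q ∈ D := hy₁.2 q ▸ h1 y₁ hy₁.1 q
        have htm : t (m q) ∈ D := h2 y₂ hy₂ _ hm ▸ h1 y₂ hy₂ _
        refine ⟨?_, htm, hm⟩
        rw [act_append, act_append, hy₁.2 q, h2 y₂ hy₂ _ hm]
        refine hfix z ?_ _ htm (h3 _ hm)
        have := kstar_mono (hUL Z)
        rw [kstar_idem] at this
        exact this hz
      have hstar : G ((E m * (U Z)∗)∗) := by
        apply hs _ (hG.mul (hEG m) ih)
        · intro x hx y hy q
          rw [(hact x hx q).1, (hact y hy q).1]
        · intro x hx q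
          obtain ⟨hxq, hd, hm⟩ := hact x hx q
          rw [hxq]
          obtain ⟨y, hy, z, hz, rfl⟩ := Language.mem_mul.1 hx
          obtain ⟨y₁, hy₁, y₂, hy₂, rfl⟩ := Language.mem_mul.1 hy
          rw [(hact _ hx _).1, ← hy₁.2, h2 _ hy₁.1 _ hd, h3 _ hm, h3 _ hm]
      refine hG.mono ?_ (hG.mul ih hstar)
      refine le_trans (kstar_mono ?_) (kstar_add_le _ _)
      rintro x ⟨m', rfl | hm', hx⟩
      · exact Or.inr hx
      · exact Or.inl ⟨m', hm', hx⟩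
  have hfin := hU Set.univ Set.finite_univ
  refine hG.mono ?_ (hG.mul hfin (hG.add hG.one hL))
  -- Group the words in pairs; an odd number of them leaves one over.
  have h : 1 * L∗ ≤ (U Set.univ)∗ * (1 + L) := by
    apply mul_kstar_le
    · calc (1 : Language X) = 1 * 1 := by simp
        _ ≤ _ := mul_le_mul' one_le_kstar le_self_add
    · have hLL : L * L ≤ U Set.univ := by
        intro x hx
        obtain ⟨y, hy, z, hz, rfl⟩ := Language.mem_mul.1 hx
        exact ⟨act δ y, trivial, Language.append_mem_mul ⟨hy, fun _ => rfl⟩ hz⟩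
      rw [mul_assoc, add_mul, mul_add, mul_add, one_mul, mul_one]
      apply add_le
      · exact le_add_self
      · refine le_trans (le_trans (mul_le_mul' le_rfl hLL) kstar_mul_le_kstar) le_self_add
  simpa using h

/-- Words whose letters act surjectively. -/
theorem ratClosed_of_surjective {X : Type u} [Finite X] {Q : Type v} [Finite Q] {δ : X → Q → Q}
    {G : Language X → Prop} (hG : IsRatClosed G) (hs : IsStarClosed δ G) (Y : Set X)
    (hY : ∀ a ∈ Y, Function.Surjective (δ a)) : G ({x | ∀ a ∈ x, a ∈ Y} : Language X) := by
  classical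
  have := Fintype.ofFinite Q
  -- Words whose run from h stays in Z. They are cut at each return to h: since h is surjective, a
  -- loop at h acts as the identity, so all loops form one idempotent class. Between returns the run
  -- avoids h, which shrinks Z.
  let P : (Q → Q) → Finset (Q → Q) → Language X := fun h Z =>
    {x | (∀ a ∈ x, a ∈ Y) ∧ ∀ p, p <+: x → act δ p ∘ h ∈ Z}
  have key : ∀ Z : Finset (Q → Q), ∀ h : Q → Q, Function.Surjective h → G (P h Z) := by
    intro Z
    induction Z using Finset.strongInduction with
    | H Z ih =>
      intro h hh
      by_cases hZ : h ∈ Z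
      swap
      · refine hG.mono ?_ hG.one
        intro x hx
        exact (hZ (hx.2 [] List.nil_prefix)).elim
      let T : Language X := {x | ∃ a ∈ Y, ∃ y ∈ P (δ a ∘ h) (Z.erase h), x = a :: y}
      have hT : G T := by
        refine hG.of_finite_cover
          (fun a : Y => ({[a.1]} : Language X) * P (δ a.1 ∘ h) (Z.erase h)) ?_ ?_
        · rintro ⟨a, ha⟩
          exact hG.mul (hG.letter a) (ih _ (Finset.erase_ssubset hZ) _ ((hY a ha).comp hh))
        · rintro x ⟨a, ha, y, hy, rfl⟩
          exact ⟨⟨a, ha⟩, Language.append_mem_mul (a := [a]) rfl hy⟩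
      let V : Language X := {x | ∃ a, x = [a]}
      have hV : G V :=
        hG.of_finite_cover (fun a : X => ({[a]} : Language X)) hG.letter
          (by rintro x ⟨a, rfl⟩; exact ⟨a, rfl⟩)
      let Λ : Language X :=
        {x | x ∈ (1 + T) * V ∧ ∀ q, act δ x q = q}
      have hΛ : G (Λ∗) := by
        apply hs
        · exact hG.mono (fun x hx => hx.1) (hG.mul (hG.add hG.one hT) hV)
        · intro x hx y hy q
          rw [hx.2, hy.2]
        · intro x hx q
          rw [hx.2]
      have hact : ∀ x, act δ x ∘ h = h → ∀ q, act δ x q = q := by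
        intro x hx q
        obtain ⟨q', rfl⟩ := hh q
        exact congrFun hx q'
      refine hG.mono ?_ (hG.mul hΛ (hG.add hG.one hT))
      intro x
      induction x using List.reverseRecOn with
      | nil =>
        intro _
        exact Language.append_mem_mul (a := []) (Language.nil_mem_kstar _) (Or.inl rfl)
      | append_singleton x b ihx =>
        intro hx
        have hb : b ∈ Y := hx.1 b (by simp)
        have hx' : x ∈ P h Z := ⟨fun a ha => hx.1 a (by simp [ha]),
          fun p hp => hx.2 p (hp.trans (List.prefix_append _ _))⟩
        obtain ⟨l, hl, z, hz, rfl⟩ := Language.mem_mul.1 (ihx hx')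
        have hlh : ∀ q, act δ l q = q := fun q =>
          kstar_induction (p := fun l => act δ l q = q) rfl
            (fun x hx y _ ih => by rw [act_append, hx.2, ih]) hl
        have hret : act δ (l ++ z ++ [b]) ∘ h = act δ (z ++ [b]) ∘ h := by
          funext q
          simp [hlh]
        rw [List.append_assoc]
        by_cases hr : act δ (z ++ [b]) ∘ h = h
        · have : l ++ (z ++ [b]) ∈ Λ∗ := by
            have hzb : z ++ [b] ∈ Λ :=
              ⟨Language.append_mem_mul hz ⟨b, rfl⟩, hact _ hr⟩
            exact (kstar_mul_le_kstar : Λ∗ * Λ ≤ Λ∗) (Language.append_mem_mul hl hzb)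
          have h2 := Language.append_mem_mul (b := []) (m := 1 + T) this (Or.inl rfl)
          rw [List.append_nil] at h2
          exact h2
        · refine Language.append_mem_mul hl (Or.inr ?_)
          have hmem : act δ (z ++ [b]) ∘ h ∈ Z.erase h :=
            Finset.mem_erase.2 ⟨hr, hret ▸ hx.2 _ List.prefix_rfl⟩
          rcases hz with hz | ⟨a, ha, y, hy, rfl⟩
          · have hz : z = [] := hz
            subst hz
            refine ⟨b, hb, [], ⟨by simp, ?_⟩, rfl⟩
            intro p hp
            rw [List.prefix_nil.1 hp]
            exact hmem
          · refine ⟨a, ha, y ++ [b], ⟨?_, ?_⟩, rfl⟩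
            · intro a' ha'
              rcases List.mem_append.1 ha' with h' | h'
              · exact hy.1 a' h'
              · rw [List.mem_singleton.1 h']
                exact hb
            · intro p hp
              rcases List.prefix_concat_iff.1 hp with rfl | hp
              · exact hmem
              · exact hy.2 p hp
  refine hG.mono ?_ (key Finset.univ id Function.surjective_id)
  intro x hx
  exact ⟨hx, fun p _ => Finset.mem_univ _⟩

/-- The image of a language under a substitution of languages for letters. -/
def subst {X' : Type v} {X : Type u} (σ : X' → Language X) (K : Language X') : Language X :=
  {x | ∃ k ∈ K, x ∈ (k.map σ).prod}

theorem subst_mul_le {X' : Type v} {X : Type u} (σ : X' → Language X) (K L : Language X') :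
    subst σ (K * L) ≤ subst σ K * subst σ L := by
  rintro x ⟨k, hk, hx⟩
  obtain ⟨k₁, h₁, k₂, h₂, rfl⟩ := Language.mem_mul.1 hk
  rw [List.map_append, List.prod_append] at hx
  obtain ⟨x₁, hx₁, x₂, hx₂, rfl⟩ := Language.mem_mul.1 hx
  exact Language.append_mem_mul ⟨k₁, h₁, hx₁⟩ ⟨k₂, h₂, hx₂⟩

theorem subst_kstar_le {X' : Type v} {X : Type u} (σ : X' → Language X) (K : Language X') :
    subst σ (K∗) ≤ (subst σ K)∗ := by
  rintro x ⟨k, hk, hx⟩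
  revert x
  refine kstar_induction
    (p := fun k => ∀ x, x ∈ (k.map σ).prod → x ∈ (subst σ K)∗) ?_ ?_ hk
  · intro x hx
    have hx : x = [] := hx
    rw [hx]
    exact Language.nil_mem_kstar _
  · intro k hk k' _ ih x hx
    rw [List.map_append, List.prod_append] at hx
    obtain ⟨x₁, hx₁, x₂, hx₂, rfl⟩ := Language.mem_mul.1 hx
    exact (mul_kstar_le_kstar : subst σ K * (subst σ K)∗ ≤ _)
      (Language.append_mem_mul ⟨k, hk, hx₁⟩ (ih x₂ hx₂))

/-- Allows the induction on states to change alphabet: a property of languages over letters becomes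
one of languages over blocks. -/
theorem isRatClosed_subst {X' : Type v} {X : Type u} {σ : X' → Language X}
    {G : Language X → Prop} (hG : IsRatClosed G) (hσ : ∀ t, G (σ t)) :
    IsRatClosed fun K => G (subst σ K) where
  mono h hL := by
    refine hG.mono ?_ hL
    rintro x ⟨k, hk, hx⟩
    exact ⟨k, h hk, hx⟩
  one := by
    refine hG.mono ?_ hG.one
    rintro x ⟨k, rfl, hx⟩
    exact hx
  letter t := by
    refine hG.mono ?_ (hσ t)
    rintro x ⟨k, rfl, hx⟩
    rw [List.map_singleton, List.prod_singleton] at hx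
    exact hx
  add hK hL := by
    refine hG.mono ?_ (hG.add hK hL)
    rintro x ⟨k, hk | hk, hx⟩
    · exact Or.inl ⟨k, hk, hx⟩
    · exact Or.inr ⟨k, hk, hx⟩
  mul hK hL := hG.mono (subst_mul_le σ _ _) (hG.mul hK hL)

/-- Induction on the number of states, then on the set Y of allowed letters. If all of Y acts
surjectively, the previous case applies. Otherwise some b has a proper image D, and words over Y
factor as blocks ending in b, followed by a word without b. The blocks act on the smaller set D, and
their b-free parts are covered by the induction on Y. -/
theorem ratClosed_top_of_card {n : ℕ} : ∀ {X Q : Type u} [Finite X] [Finite Q],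
    Nat.card Q = n → ∀ (δ : X → Q → Q) (G : Language X → Prop), IsRatClosed G →
    IsStarClosed δ G → G ⊤ := by
  induction n using Nat.strong_induction_on with
  | _ n ihn =>
  intro X Q _ _ hn δ G hG hs
  classical
  have := Fintype.ofFinite X
  have key : ∀ Y : Finset X, G ({x | ∀ a ∈ x, a ∈ Y} : Language X) := by
    intro Y
    induction Y using Finset.strongInduction with
    | H Y ihY =>
    by_cases hY : ∀ a ∈ Y, Function.Surjective (δ a)
    · exact ratClosed_of_surjective hG hs (Y : Set X) hY
    push Not at hY
    obtain ⟨b, hb, hsurj⟩ := hY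
    let B : Language X := {x | ∀ a ∈ x, a ∈ Y.erase b}
    have hB : G B := ihY _ (Finset.erase_ssubset hb)
    let D : Set Q := Set.range (δ b)
    -- A new letter is a self-map t of D; it stands for all blocks acting on D as t.
    let σ : (D → D) → Language X := fun t =>
      {x | (∃ y ∈ B, x = y ++ [b]) ∧ ∀ q : D, act δ x q = t q}
    have hcard : Nat.card D < n := by
      rw [← hn]
      have hD : D ≠ Set.univ := fun h => hsurj (Set.range_eq_univ.1 h)
      have := Set.ncard_lt_card hD
      simpa [Nat.card_coe_set_eq] using this
    have hσ : ∀ t, G (σ t) := by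
      intro t
      refine hG.mono ?_ (hG.mul hB (hG.letter b))
      rintro x ⟨⟨y, hy, rfl⟩, -⟩
      exact Language.append_mem_mul hy rfl
    have hmem : ∀ k : List (D → D), ∀ x ∈ (k.map σ).prod,
        (∀ q : D, act δ x q = act (fun t : D → D => t) k q) ∧
          (x ≠ [] → ∀ q, act δ x q ∈ D) := by
      intro k
      induction k with
      | nil =>
        intro x hx
        have hx : x = [] := hx
        subst hx
        exact ⟨fun q => rfl, fun h => (h rfl).elim⟩
      | cons t k ih =>
        intro x hx
        rw [List.map_cons, List.prod_cons] at hx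
        obtain ⟨x₁, ⟨⟨y, hy, rfl⟩, hx₁⟩, x₂, hx₂, rfl⟩ := Language.mem_mul.1 hx
        obtain ⟨ih1, ih2⟩ := ih x₂ hx₂
        constructor
        · intro q
          rw [act_append, hx₁ q, ih1]
          rfl
        · intro _ q
          rw [act_append]
          by_cases h : x₂ = []
          · subst h
            simp only [act_append, act_cons, act_nil]
            exact ⟨_, rfl⟩
          · exact ih2 h _
    have htop : G (subst σ ⊤) := by
      refine ihn _ hcard rfl (fun t : D → D => t) (fun K => G (subst σ K))
        (isRatClosed_subst hG hσ) ?_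
      intro L hL hL1 hL2
      by_cases hne : ∃ k, k ∈ L
      swap
      · refine hG.mono (subst_kstar_le σ L) (hG.mono ?_ hG.one)
        intro x hx
        refine kstar_induction (p := fun x => x ∈ (1 : Language X)) rfl ?_ hx
        rintro y ⟨k, hk, -⟩
        exact (hne ⟨k, hk⟩).elim
      obtain ⟨k₀, hk₀⟩ := hne
      -- Only nonempty words are sure to map all states into D; discarding the empty word does not
      -- change the star.
      let L' : Language X := {x | x ∈ subst σ L ∧ x ≠ []}
      have hL' : G (L'∗) := by
        refine kstar_of_retract hG hs (hG.mono (fun x hx => hx.1) hL) D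
          (fun q => if h : q ∈ D then (act (fun t : D → D => t) k₀ ⟨q, h⟩ : D) else q) ?_ ?_ ?_
        · rintro x ⟨⟨k, hk, hx⟩, hx0⟩ q
          exact (hmem k x hx).2 hx0 q
        · rintro x ⟨⟨k, hk, hx⟩, hx0⟩ q hq
          rw [dif_pos hq, hL1 k₀ hk₀ k hk]
          exact (hmem k x hx).1 ⟨q, hq⟩
        · intro q hq
          simp only [hq, dite_true, Subtype.coe_prop]
          rw [hL2 k₀ hk₀]
      refine hG.mono ((subst_kstar_le σ L).trans ?_) hL'
      rw [Language.kstar_def_nonempty]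
      rintro x ⟨l, rfl, hl⟩
      exact Language.join_mem_kstar fun y hy => hl y hy
    refine hG.mono ?_ (hG.mul htop hB)
    intro x
    induction x using List.reverseRecOn with
    | nil =>
      intro _
      exact Language.append_mem_mul (a := []) ⟨[], trivial, rfl⟩ (fun a ha => by simp at ha)
    | append_singleton x a ih =>
      intro hx
      obtain ⟨y, ⟨k, -, hy⟩, z, hz, rfl⟩ :=
        Language.mem_mul.1 (ih fun a ha => hx a (by simp [ha]))
      rw [List.append_assoc]
      by_cases hab : a = b
      · subst hab
        let t : D → D := fun q => ⟨act δ (z ++ [a]) q, by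
          simp only [act_append, act_cons, act_nil]; exact ⟨_, rfl⟩⟩
        have ht : z ++ [a] ∈ σ t := ⟨⟨z, hz, rfl⟩, fun q => rfl⟩
        have : y ++ (z ++ [a]) ∈ subst σ ⊤ := by
          refine ⟨k ++ [t], trivial, ?_⟩
          rw [List.map_append, List.prod_append]
          exact Language.append_mem_mul hy (by simpa using ht)
        have h2 := Language.append_mem_mul (b := []) (m := B) this (fun a ha => by simp at ha)
        rw [List.append_nil] at h2
        exact h2
      · refine Language.append_mem_mul ⟨k, trivial, hy⟩ ?_
        intro a' ha'
        rcases List.mem_append.1 ha' with h' | h'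
        · exact hz a' h'
        · rw [List.mem_singleton.1 h']
          exact Finset.mem_erase.2 ⟨hab, hx a (by simp)⟩
  refine hG.mono ?_ (key Finset.univ)
  intro x _ a _
  exact Finset.mem_univ a

/-- An equivalence on words that is compatible with concatenation. -/
def IsCong {A : Type u} (c : Setoid (List A)) : Prop :=
  ∀ x x' y y', c x x' → c y y' → c (x ++ y) (x' ++ y')

/-- **Factorization principle.** A predicate on languages that is closed under sublanguages, union,
product, and under the star of languages contained in one idempotent class of a finite congruence
holds for the language of all words. -/
theorem ratClosed_top {A : Type u} [Finite A] {c : Setoid (List A)} (hc : IsCong c)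
    [Finite (Quotient c)] {G : Language A → Prop} (hG : IsRatClosed G)
    (hs : ∀ L : Language A, G L → (∀ x ∈ L, ∀ y ∈ L, c x y) → (∀ x ∈ L, c (x ++ x) x) →
      G (L∗)) : G ⊤ := by
  -- Right multiplication on the quotient monoid; the action on the class of the empty word recovers
  -- the class of a word.
  let δ : A → Quotient c → Quotient c := fun a =>
    Quotient.map (fun x => x ++ [a]) (fun x y h => hc _ _ _ _ h (c.refl _))
  have hδ : ∀ x y, act δ x (Quotient.mk c y) = Quotient.mk c (y ++ x) := by
    intro x
    induction x with
    | nil => intro y; simp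
    | cons a x ih =>
      intro y
      rw [act_cons]
      change act δ x (Quotient.mk c (y ++ [a])) = _
      rw [ih]
      simp
  refine ratClosed_top_of_card (Q := Quotient c) rfl δ G hG ?_
  intro L hL h1 h2
  refine hs L hL ?_ ?_
  · intro x hx y hy
    have := h1 x hx y hy (Quotient.mk c [])
    rw [hδ, hδ] at this
    exact Quotient.exact this
  · intro x hx
    have := h2 x hx (Quotient.mk c [])
    rw [hδ, hδ] at this
    exact Quotient.exact this

/-! ### Bracketing by idempotents in a finite semigroup -/

/-- The product of a list of elements of a semigroup; it is `1` for the empty list. -/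
def sprod {V : Type u} [Semigroup V] (l : List V) : WithOne V := (l.map WithOne.coe).prod

@[simp] theorem sprod_nil {V : Type u} [Semigroup V] : sprod ([] : List V) = 1 := rfl

@[simp] theorem sprod_append {V : Type u} [Semigroup V] (l l' : List V) :
    sprod (l ++ l') = sprod l * sprod l' := by
  simp [sprod]

@[simp] theorem sprod_cons {V : Type u} [Semigroup V] (a : V) (l : List V) :
    sprod (a :: l) = (a : WithOne V) * sprod l := by
  simp [sprod]

theorem exists_sprod_eq_coe {V : Type u} [Semigroup V] {l : List V} (hl : l ≠ []) :
    ∃ g : V, sprod l = g := by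
  induction l with
  | nil => exact (hl rfl).elim
  | cons a l ih =>
    by_cases h : l = []
    · exact ⟨a, by simp [h]⟩
    · obtain ⟨g, hg⟩ := ih h
      exact ⟨a * g, by simp [hg]⟩

theorem ne_nil_of_sprod_eq_coe {V : Type u} [Semigroup V] {l : List V} {g : V}
    (h : sprod l = g) : l ≠ [] := by
  rintro rfl
  exact WithOne.one_ne_coe h

/-- Long lists over a finite semigroup have a factor with idempotent product. -/
theorem exists_idempotent_factor (V : Type u) [Semigroup V] [Finite V] :
    ∃ N : ℕ, ∀ x : List V, N ≤ x.length → ∃ p b q, ∃ g : V, x = p ++ b ++ q ∧ g * g = g ∧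
      sprod b = g := by
  let c : Setoid (List V) := Setoid.ker sprod
  have hc : IsCong c := by
    intro x x' y y' hx hy
    change sprod _ = sprod _
    rw [sprod_append, sprod_append, show sprod x = sprod x' from hx,
      show sprod y = sprod y' from hy]
  have : Finite (WithOne V) := inferInstanceAs (Finite (Option V))
  have : Finite (Quotient c) := Finite.of_injective _ (Setoid.kerLift_injective sprod)
  let Has : List V → Prop := fun x => ∃ p b q, ∃ g : V, x = p ++ b ++ q ∧ g * g = g ∧ sprod b = g
  let G : Language V → Prop := fun L => ∃ N : ℕ, ∀ x ∈ L, N ≤ x.length → Has x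
  have hG : IsRatClosed G := by
    refine ⟨?_, ⟨1, ?_⟩, fun a => ⟨2, ?_⟩, ?_, ?_⟩
    · rintro K L hKL ⟨N, hN⟩
      exact ⟨N, fun x hx => hN x (hKL hx)⟩
    · rintro x rfl h
      simp at h
    · rintro x rfl h
      simp at h
    · rintro K L ⟨N, hN⟩ ⟨N', hN'⟩
      refine ⟨max N N', ?_⟩
      rintro x (hx | hx) h
      · exact hN x hx (le_trans (le_max_left _ _) h)
      · exact hN' x hx (le_trans (le_max_right _ _) h)
    · rintro K L ⟨N, hN⟩ ⟨N', hN'⟩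
      refine ⟨N + N', ?_⟩
      intro x hx h
      obtain ⟨y, hy, z, hz, rfl⟩ := Language.mem_mul.1 hx
      rw [List.length_append] at h
      rcases (by omega : N ≤ y.length ∨ N' ≤ z.length) with h | h
      · obtain ⟨p, b, q, g, rfl, hg⟩ := hN y hy h
        exact ⟨p, b, q ++ z, g, by simp, hg⟩
      · obtain ⟨p, b, q, g, rfl, hg⟩ := hN' z hz h
        exact ⟨y ++ p, b, q, g, by simp, hg⟩
  have htop : G ⊤ := by
    refine ratClosed_top hc hG ?_
    intro L _ _ hL
    -- A nonempty word of L∗ starts with a nonempty word of L, whose product is already idempotent.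
    refine ⟨1, ?_⟩
    intro x hx h
    obtain ⟨l, rfl, hl⟩ := Language.mem_kstar_iff_exists_nonempty.1 hx
    rcases l with _ | ⟨y, l⟩
    · simp at h
    · obtain ⟨hy, hy0⟩ := hl y List.mem_cons_self
      obtain ⟨g, hg⟩ := exists_sprod_eq_coe hy0
      refine ⟨[], y, l.flatten, g, by simp, ?_, hg⟩
      have := hL y hy
      change sprod _ = sprod _ at this
      rw [sprod_append, hg, ← WithOne.coe_mul] at this
      exact WithOne.coe_inj.1 this
  obtain ⟨N, hN⟩ := htop
  exact ⟨N, fun x => hN x trivial⟩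

theorem exists_first_factor {V : Type u} {B : Set (List V)} (hB : [] ∉ B) {x : List V}
    (h : ∃ p, ∃ b ∈ B, ∃ q, x = p ++ b ++ q) :
    ∃ p, ∃ b ∈ B, ∃ q, x = p ++ b ++ q ∧ ¬ ∃ p', ∃ b' ∈ B, ∃ q', p = p' ++ b' ++ q' := by
  obtain ⟨p, hp⟩ := h
  induction hn : p.length using Nat.strong_induction_on generalizing p with
  | _ n ih =>
    obtain ⟨b, hb, q, rfl⟩ := hp
    by_cases h : ∃ p', ∃ b' ∈ B, ∃ q', p = p' ++ b' ++ q'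
    · obtain ⟨p', b', hb', q', rfl⟩ := h
      have hpos : 0 < b'.length := List.length_pos_iff.2 fun h0 => hB (h0 ▸ hb')
      simp only [List.length_append] at hn
      exact ih _ (by omega) p' ⟨b', hb', q' ++ b ++ q, by simp⟩ rfl
    · exact ⟨p, b, hb, q, rfl, h⟩

theorem exists_last_factor {V : Type u} {B : Set (List V)} (hB : [] ∉ B) {x : List V}
    (h : ∃ p, ∃ b ∈ B, ∃ q, x = p ++ b ++ q) :
    ∃ p, ∃ b ∈ B, ∃ q, x = p ++ b ++ q ∧ ¬ ∃ p', ∃ b' ∈ B, ∃ q', q = p' ++ b' ++ q' := by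
  obtain ⟨p, b, hb, q, hx⟩ := h
  induction hn : q.length using Nat.strong_induction_on generalizing p b q with
  | _ n ih =>
    by_cases h : ∃ p', ∃ b' ∈ B, ∃ q', q = p' ++ b' ++ q'
    · obtain ⟨p', b', hb', q', rfl⟩ := h
      have hpos : 0 < b'.length := List.length_pos_iff.2 fun h0 => hB (h0 ▸ hb')
      simp only [List.length_append] at hn
      exact ih _ (by omega) (p ++ b ++ p') b' hb' q' (by simp [hx]) rfl
    · exact ⟨p, b, hb, q, hx, h⟩

theorem IsRatClosed.singleton {X : Type u} {G : Language X → Prop} (hG : IsRatClosed G)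
    (x : List X) : G {x} := by
  induction x with
  | nil => exact hG.one
  | cons a x ih =>
    refine hG.mono ?_ (hG.mul (hG.letter a) ih)
    rintro y rfl
    exact Language.append_mem_mul (a := [a]) rfl rfl

/-- **Bracketing principle.** A predicate on languages over a finite semigroup that is closed
under sublanguages, union and product, and that holds for the language of all lists bracketed by
two given lists with the same idempotent product, holds for the language of all lists. -/
theorem ratClosed_top_of_bracket {V : Type u} [Semigroup V] [Finite V] {G : Language V → Prop}
    (hG : IsRatClosed G)
    (hb : ∀ (g : V) (l l' : List V), g * g = g → sprod l = g → sprod l' = g →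
      G ({x | ∃ m, x = l ++ m ++ l'} : Language V)) : G ⊤ := by
  obtain ⟨N, hN⟩ := exists_idempotent_factor V
  let B : V → Set (List V) := fun g => {b | b.length ≤ N ∧ g * g = g ∧ sprod b = g}
  have hB0 : ∀ g, [] ∉ B g := fun g h => ne_nil_of_sprod_eq_coe h.2.2 rfl
  have hBfin : ∀ g, (B g).Finite := fun g =>
    (List.finite_length_le V N).subset fun b hb => hb.1
  -- Lists whose idempotent factors of length at most N have their products in Y; for empty Y these
  -- lists have length at most N. To add g to Y, cut at the first and the last short factor with
  -- product g: the outer parts lie in `W Y` and the middle is bracketed. There are finitely many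
  -- possible brackets, so the bound may depend on them.
  let W : Set V → Language V := fun Y => {x | ∀ g, (∃ p, ∃ b ∈ B g, ∃ q, x = p ++ b ++ q) → g ∈ Y}
  have key : ∀ Y : Set V, Y.Finite → G (W Y) := by
    intro Y hY
    induction Y, hY using Set.Finite.induction_on with
    | empty =>
      have : Finite {x : List V | x.length ≤ N} := List.finite_length_le V N
      refine hG.of_finite_cover (fun x : {x : List V | x.length ≤ N} => ({x.1} : Language V))
        (fun x => hG.singleton _) ?_
      intro x hx
      have hlen : x.length ≤ N := by
        by_contra hlt
        obtain ⟨p, b, q, g, hpb, hg, hbg⟩ := hN (x.take N) (by simp; omega)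
        have hbl : b.length ≤ N := by
          have := congrArg List.length hpb
          simp only [List.length_append, List.length_take] at this
          omega
        refine hx g ⟨p, b, ⟨hbl, hg, hbg⟩, q ++ x.drop N, ?_⟩
        rw [← List.append_assoc, ← hpb, List.take_append_drop]
      exact ⟨⟨x, hlen⟩, rfl⟩
    | @insert g Y _ _ ih =>
      have : Finite (B g) := hBfin g
      let Z : B g → B g → Language V := fun b b' => {x | ∃ m, x = b.1 ++ m ++ b'.1}
      have hW : ∀ x ∈ W (insert g Y), ∀ p z q, x = p ++ z ++ q →
          (¬ ∃ p', ∃ b ∈ B g, ∃ q', z = p' ++ b ++ q') → z ∈ W Y := by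
        rintro x hx p z q rfl hz g' ⟨p', b, hb, q', rfl⟩
        rcases hx g' ⟨p ++ p', b, hb, q' ++ q, by simp⟩ with rfl | h
        · exact (hz ⟨p', b, hb, q', rfl⟩).elim
        · exact h
      have hZ : G ({x | ∃ b b', x ∈ W Y * Z b b' * W Y} : Language V) := by
        refine hG.of_finite_cover (fun i : B g × B g => W Y * Z i.1 i.2 * W Y) ?_ ?_
        · rintro ⟨b, b'⟩
          exact hG.mul (hG.mul ih (hb g _ _ b.2.2.1 b.2.2.2 b'.2.2.2)) ih
        · rintro x ⟨b, b', hx⟩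
          exact ⟨(b, b'), hx⟩
      have hS : G ({x | ∃ b : B g, x ∈ W Y * {b.1} * W Y} : Language V) := by
        refine hG.of_finite_cover (fun b : B g => W Y * {b.1} * W Y) ?_ ?_
        · intro b
          exact hG.mul (hG.mul ih (hG.singleton _)) ih
        · rintro x ⟨b, hx⟩
          exact ⟨b, hx⟩
      refine hG.mono ?_ (hG.add (hG.add ih hS) hZ)
      intro x hx
      by_cases hxg : ∃ p, ∃ b ∈ B g, ∃ q, x = p ++ b ++ q
      swap
      · exact Or.inl (Or.inl (hW x hx [] x [] (by simp) hxg))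
      obtain ⟨p, b, hb, y, rfl, hp⟩ := exists_first_factor (hB0 g) hxg
      have hpW : p ∈ W Y := hW _ hx [] p (b ++ y) (by simp) hp
      by_cases hyg : ∃ p, ∃ b ∈ B g, ∃ q, y = p ++ b ++ q
      swap
      · have hyW : y ∈ W Y := hW _ hx (p ++ b) y [] (by simp) hyg
        exact Or.inl (Or.inr ⟨⟨b, hb⟩,
          Language.append_mem_mul (Language.append_mem_mul hpW rfl) hyW⟩)
      obtain ⟨m, b', hb', q, rfl, hq⟩ := exists_last_factor (hB0 g) hyg
      have hqW : q ∈ W Y := hW _ hx (p ++ b ++ m ++ b') q [] (by simp) hq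
      refine Or.inr ⟨⟨b, hb⟩, ⟨b', hb'⟩, ?_⟩
      have := Language.append_mem_mul (Language.append_mem_mul (m := Z ⟨b, hb⟩ ⟨b', hb'⟩)
        hpW ⟨m, rfl⟩) hqW
      simpa using this
  refine hG.mono ?_ (key Set.univ Set.finite_univ)
  intro x _ g _
  trivial

/-! ### Stratification of the polynomial closure -/

/-- The `n`-th preorder of the polynomial closure of the class of `c`-saturated languages. -/
def pre {A : Type u} (c : Setoid (List A)) : ℕ → List A → List A → Prop
  | 0, x, y => c x y
  | n + 1, x, y => pre c n x y ∧ ∀ x₁ a x₂, x = x₁ ++ a :: x₂ →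
      ∃ y₁ y₂, y = y₁ ++ a :: y₂ ∧ pre c n x₁ y₁ ∧ pre c n x₂ y₂

theorem pre_refl {A : Type u} (c : Setoid (List A)) (n : ℕ) (x : List A) : pre c n x x := by
  induction n generalizing x with
  | zero => exact c.refl x
  | succ n ih => exact ⟨ih x, fun x₁ a x₂ h => ⟨x₁, x₂, h, ih _, ih _⟩⟩

theorem pre_trans {A : Type u} {c : Setoid (List A)} {n : ℕ} {x y z : List A}
    (h : pre c n x y) (h' : pre c n y z) : pre c n x z := by
  induction n generalizing x y z with
  | zero => exact c.trans h h'
  | succ n ih =>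
    refine ⟨ih h.1 h'.1, fun x₁ a x₂ hx => ?_⟩
    obtain ⟨y₁, y₂, hy, h₁, h₂⟩ := h.2 x₁ a x₂ hx
    obtain ⟨z₁, z₂, hz, h₃, h₄⟩ := h'.2 y₁ a y₂ hy
    exact ⟨z₁, z₂, hz, ih h₁ h₃, ih h₂ h₄⟩

theorem pre_of_le {A : Type u} {c : Setoid (List A)} {n m : ℕ} (hnm : n ≤ m) {x y : List A}
    (h : pre c m x y) : pre c n x y := by
  induction hnm with
  | refl => exact h
  | step _ ih => exact ih h.1

theorem pre_setoid_mono {A : Type u} {c c' : Setoid (List A)} (hc : ∀ x y, c x y → c' x y)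
    {n : ℕ} {x y : List A} (h : pre c n x y) : pre c' n x y := by
  induction n generalizing x y with
  | zero => exact hc x y h
  | succ n ih =>
    refine ⟨ih h.1, fun x₁ a x₂ hx => ?_⟩
    obtain ⟨y₁, y₂, hy, h₁, h₂⟩ := h.2 x₁ a x₂ hx
    exact ⟨y₁, y₂, hy, ih h₁, ih h₂⟩

theorem pre_append {A : Type u} {c : Setoid (List A)} (hc : IsCong c) {n : ℕ}
    {x x' y y' : List A} (hx : pre c n x x') (hy : pre c n y y') :
    pre c n (x ++ y) (x' ++ y') := by
  induction n generalizing x x' y y' with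
  | zero => exact hc _ _ _ _ hx hy
  | succ n ih =>
    refine ⟨ih hx.1 hy.1, fun z a z' h => ?_⟩
    rcases List.append_eq_append_iff.1 h with ⟨t, rfl, ht⟩ | ⟨t, rfl, ht⟩
    · obtain ⟨y₁, y₂, rfl, h₁, h₂⟩ := hy.2 _ _ _ ht
      exact ⟨x' ++ y₁, y₂, by simp, ih hx.1 h₁, h₂⟩
    · rcases t with _ | ⟨b, t⟩
      · obtain ⟨y₁, y₂, rfl, h₁, h₂⟩ := hy.2 [] a z' ht.symm
        refine ⟨x' ++ y₁, y₂, by simp, ?_, h₂⟩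
        have := ih hx.1 h₁
        simpa using this
      · rw [List.cons_append, List.cons.injEq] at ht
        obtain ⟨rfl, rfl⟩ := ht
        obtain ⟨x₁, x₂, rfl, h₁, h₂⟩ := hx.2 _ _ _ rfl
        exact ⟨x₁, x₂ ++ y', by simp, h₁, ih h₂ hy.1⟩

/-- The first letter of the second half serves as the mark; this costs one level. -/
theorem pre_split {A : Type u} {c : Setoid (List A)} (hc : IsCong c) {n : ℕ}
    {x y z : List A} (h : pre c (n + 1) (x ++ y) z) :
    ∃ z₁ z₂, z = z₁ ++ z₂ ∧ pre c n x z₁ ∧ pre c n y z₂ := by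
  rcases y with _ | ⟨a, y⟩
  · exact ⟨z, [], by simp, by simpa using h.1, pre_refl _ _ _⟩
  · obtain ⟨z₁, z₂, rfl, h₁, h₂⟩ := h.2 x a y rfl
    exact ⟨z₁, a :: z₂, rfl, h₁, pre_append hc (x := [a]) (pre_refl _ _ _) h₂⟩

/-- The language of the words above `x` in the `n`-th preorder. -/
def up {A : Type u} (c : Setoid (List A)) (n : ℕ) (x : List A) : Language A := {y | pre c n x y}

/-- The `c`-saturated languages. -/
def satLang {A : Type u} (c : Setoid (List A)) : Set (Language A) :=
  {L | ∀ x y, c x y → x ∈ L → y ∈ L}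

theorem up_zero_mem_satLang {A : Type u} (c : Setoid (List A)) (x : List A) :
    up c 0 x ∈ satLang c := fun _ _ h hx => c.trans hx h

theorem finite_range_up_zero {A : Type u} (c : Setoid (List A)) [Finite (Quotient c)] :
    (Set.range (up c 0)).Finite := by
  refine (Set.finite_range (Quotient.lift (s := c) (up c 0) ?_)).subset ?_
  · intro x y h
    exact Language.ext fun z => ⟨fun hz => c.trans (c.symm h) hz, fun hz => c.trans h hz⟩
  · rintro _ ⟨x, rfl⟩
    exact ⟨Quotient.mk c x, rfl⟩

/-- A principal upset at level n + 1 depends only on the upset of x at level n and on the set of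
triples (upset of x₁, a, upset of x₂) for x = x₁ a x₂, which leaves finitely many possibilities. -/
theorem finite_range_up {A : Type u} [Finite A] (c : Setoid (List A)) [Finite (Quotient c)]
    (n : ℕ) : (Set.range (up c n)).Finite := by
  induction n with
  | zero => exact finite_range_up_zero c
  | succ n ih =>
    let U := Set.range (up c n)
    let F : Language A × Set (Language A × A × Language A) → Language A := fun p =>
      {z | z ∈ p.1 ∧ ∀ q ∈ p.2, ∃ z₁ z₂, z = z₁ ++ q.2.1 :: z₂ ∧ z₁ ∈ q.1 ∧ z₂ ∈ q.2.2}
    have hfin : (U ×ˢ 𝒫 (U ×ˢ (Set.univ : Set A) ×ˢ U)).Finite :=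
      ih.prod (ih.prod (Set.finite_univ.prod ih)).finite_subsets
    refine (hfin.image F).subset ?_
    rintro _ ⟨x, rfl⟩
    refine ⟨(up c n x, {q | ∃ x₁ a x₂, x = x₁ ++ a :: x₂ ∧ q = (up c n x₁, a, up c n x₂)}),
      ⟨⟨x, rfl⟩, ?_⟩, ?_⟩
    · rintro _ ⟨x₁, a, x₂, -, rfl⟩
      exact ⟨⟨x₁, rfl⟩, trivial, ⟨x₂, rfl⟩⟩
    · refine Language.ext fun z => ⟨?_, ?_⟩
      · rintro ⟨h1, h2⟩
        refine ⟨h1, fun x₁ a x₂ h => ?_⟩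
        exact h2 _ ⟨x₁, a, x₂, h, rfl⟩
      · rintro ⟨h1, h2⟩
        refine ⟨h1, ?_⟩
        rintro _ ⟨x₁, a, x₂, h, rfl⟩
        exact h2 x₁ a x₂ h

/-! ### Monomials, and intersections in the polynomial closure -/

/-- Monomials: marked products of classes of `c`, with the number of marked letters. -/
inductive IsMono {A : Type u} (c : Setoid (List A)) : ℕ → Language A → Prop
  | base (x : List A) : IsMono c 0 (up c 0 x)
  | cons (x : List A) (a : A) {n : ℕ} {m : Language A} :
      IsMono c n m → IsMono c (n + 1) (up c 0 x * {[a]} * m)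

theorem mem_marked {A : Type u} {K L : Language A} {a : A} {z : List A} :
    z ∈ K * {[a]} * L ↔ ∃ x ∈ K, ∃ y ∈ L, z = x ++ a :: y := by
  constructor
  · intro h
    obtain ⟨w, hw, y, hy, rfl⟩ := Language.mem_mul.1 h
    obtain ⟨x, hx, _, rfl, rfl⟩ := Language.mem_mul.1 hw
    exact ⟨x, hx, y, hy, by simp⟩
  · rintro ⟨x, hx, y, hy, rfl⟩
    have := Language.append_mem_mul (m := L)
      (Language.append_mem_mul (b := [a]) (m := {[a]}) hx rfl) hy
    rwa [List.append_assoc] at this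

theorem IsMono.cong {A : Type u} {c : Setoid (List A)} (hc : IsCong c) {n : ℕ} {m : Language A}
    (h : IsMono c n m) {x y : List A} (hx : x ∈ m) (hy : y ∈ m) : c x y := by
  induction h generalizing x y with
  | base z => exact c.trans (c.symm hx) hy
  | cons z a _ ih =>
    obtain ⟨x₁, hx₁, x₂, hx₂, rfl⟩ := mem_marked.1 hx
    obtain ⟨y₁, hy₁, y₂, hy₂, rfl⟩ := mem_marked.1 hy
    exact hc _ _ _ _ (c.trans (c.symm hx₁) hy₁) (hc [a] [a] _ _ (c.refl _) (ih hx₂ hy₂))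

theorem IsMono.marked {A : Type u} {c : Setoid (List A)} {n n' : ℕ} {m m' : Language A}
    (h : IsMono c n m) (a : A) (h' : IsMono c n' m') : IsMono c (n + n' + 1) (m * {[a]} * m') := by
  induction h with
  | base z =>
    rw [Nat.zero_add]
    exact .cons z a h'
  | @cons z b n m _ ih =>
    have : up c 0 z * {[b]} * m * {[a]} * m' = up c 0 z * {[b]} * (m * {[a]} * m') := by
      simp only [mul_assoc]
    rw [this, show n + 1 + n' + 1 = n + n' + 1 + 1 by omega]
    exact .cons z b ih

theorem finite_isMono {A : Type u} [Finite A] (c : Setoid (List A)) [Finite (Quotient c)] (n : ℕ) :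
    {m | IsMono c n m}.Finite := by
  induction n with
  | zero =>
    refine (finite_range_up_zero c).subset ?_
    rintro _ ⟨x⟩
    exact ⟨x, rfl⟩
  | succ n ih =>
    refine ((((finite_range_up_zero c).prod (Set.finite_univ (α := A))).prod ih).image
      (fun p => p.1.1 * {[p.1.2]} * p.2)).subset ?_
    rintro _ h
    cases h with
    | cons x a h => exact ⟨((up c 0 x, a), _), ⟨⟨⟨x, rfl⟩, trivial⟩, h⟩, rfl⟩

/-- Both monomials mark positions of x; the monomial that marks all these positions and takes the
class of x between them refines both. The degrees add up at most, so boundedness survives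
intersection. -/
theorem IsMono.refine_inf {A : Type u} {c : Setoid (List A)} (hc : IsCong c) {N : ℕ} :
    ∀ {n₁ n₂ : ℕ} {m₁ m₂ : Language A}, n₁ + n₂ = N → IsMono c n₁ m₁ → IsMono c n₂ m₂ →
    ∀ x, x ∈ m₁ → x ∈ m₂ → ∃ n ≤ n₁ + n₂, ∃ m, IsMono c n m ∧ x ∈ m ∧ m ≤ m₁ ∧ m ≤ m₂ := by
  induction N using Nat.strong_induction_on with
  | _ N ih =>
  have base : ∀ {n : ℕ} {m : Language A} (z x : List A), IsMono c n m → x ∈ m → x ∈ up c 0 z →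
      m ≤ up c 0 z := fun z x h hx hz y hy => c.trans hz (h.cong hc hx hy)
  -- The mark a comes strictly before b. Keep the first class and a, then merge the tail of the
  -- first monomial with the second one, whose initial class is replaced by the class of t. The
  -- congruence recovers the class of x₁ a t.
  have step : ∀ {n₁ n₂ : ℕ} {m₁ m₂ : Language A} (z₁ z₂ : List A) (a b : A),
      n₁ + 1 + (n₂ + 1) = N → IsMono c n₁ m₁ → IsMono c n₂ m₂ → ∀ x₁ t x₂, x₁ ∈ up c 0 z₁ →
      x₁ ++ a :: t ∈ up c 0 z₂ → t ++ b :: x₂ ∈ m₁ → x₂ ∈ m₂ →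
      ∃ n ≤ n₁ + 1 + (n₂ + 1), ∃ m, IsMono c n m ∧ x₁ ++ a :: (t ++ b :: x₂) ∈ m ∧
        m ≤ up c 0 z₁ * {[a]} * m₁ ∧ m ≤ up c 0 z₂ * {[b]} * m₂ := by
    intro n₁ n₂ m₁ m₂ z₁ z₂ a b hN h₁ h₂ x₁ t x₂ hx₁ hz₂ hm₁ hm₂
    obtain ⟨n, hn, m, hm, hxm, hmm₁, hmm₂⟩ := ih (n₁ + (n₂ + 1)) (by omega) rfl h₁ (.cons t b h₂)
      (t ++ b :: x₂) hm₁ (mem_marked.2 ⟨t, c.refl t, x₂, hm₂, rfl⟩)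
    refine ⟨n + 1, by omega, _, .cons z₁ a hm, mem_marked.2 ⟨x₁, hx₁, _, hxm, rfl⟩,
      mul_le_mul' le_rfl hmm₁, ?_⟩
    intro y hy
    obtain ⟨y₁, hy₁, y₂, hy₂, rfl⟩ := mem_marked.1 hy
    obtain ⟨t', ht', y₃, hy₃, rfl⟩ := mem_marked.1 (hmm₂ hy₂)
    refine mem_marked.2 ⟨y₁ ++ a :: t', ?_, y₃, hy₃, by simp⟩
    exact c.trans hz₂
      (hc _ _ _ _ (c.trans (c.symm hx₁) hy₁) (hc [a] [a] _ _ (c.refl _) ht'))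
  intro n₁ n₂ m₁ m₂ hN h₁ h₂ x hxm₁ hxm₂
  cases h₁ with
  | base z => exact ⟨n₂, by omega, m₂, h₂, hxm₂, base z x h₂ hxm₂ hxm₁, le_rfl⟩
  | @cons z₁ a n₁ m₁ h₁ =>
    cases h₂ with
    | base z =>
      have h := IsMono.cons z₁ a h₁
      exact ⟨_, by omega, _, h, hxm₁, le_rfl, base z x h hxm₁ hxm₂⟩
    | @cons z₂ b n₂ m₂ h₂ =>
      obtain ⟨x₁, hx₁, y₁, hy₁, rfl⟩ := mem_marked.1 hxm₁
      obtain ⟨x₂, hx₂, y₂, hy₂, heq⟩ := mem_marked.1 hxm₂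
      rcases List.append_eq_append_iff.1 heq with ⟨t, rfl, ht⟩ | ⟨t, rfl, ht⟩
      · rcases t with _ | ⟨a', t⟩
        · rw [List.nil_append, List.cons.injEq] at ht
          obtain ⟨rfl, rfl⟩ := ht
          rw [List.append_nil] at hx₂
          obtain ⟨n, hn, m, hm, hxm, hm₁, hm₂⟩ := ih (n₁ + n₂) (by omega) rfl h₁ h₂ _ hy₁ hy₂
          refine ⟨n + 1, by omega, _, .cons z₁ a hm, mem_marked.2 ⟨x₁, hx₁, _, hxm, rfl⟩,
            mul_le_mul' le_rfl hm₁, mul_le_mul' (mul_le_mul' ?_ le_rfl) hm₂⟩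
          exact fun y hy => c.trans hx₂ (c.trans (c.symm hx₁) hy)
        · rw [List.cons_append, List.cons.injEq] at ht
          obtain ⟨rfl, rfl⟩ := ht
          exact step z₁ z₂ a b hN h₁ h₂ x₁ t y₂ hx₁ hx₂ hy₁ hy₂
      · rcases t with _ | ⟨a', t⟩
        · rw [List.nil_append, List.cons.injEq] at ht
          obtain ⟨rfl, rfl⟩ := ht
          rw [List.append_nil] at hx₁
          obtain ⟨n, hn, m, hm, hxm, hm₁, hm₂⟩ := ih (n₁ + n₂) (by omega) rfl h₁ h₂ _ hy₁ hy₂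
          refine ⟨n + 1, by omega, _, .cons z₁ b hm,
            mem_marked.2 ⟨x₂, hx₁, _, hxm, by simp⟩,
            mul_le_mul' le_rfl hm₁, mul_le_mul' (mul_le_mul' ?_ le_rfl) hm₂⟩
          exact fun y hy => c.trans hx₂ (c.trans (c.symm hx₁) hy)
        · rw [List.cons_append, List.cons.injEq] at ht
          obtain ⟨rfl, rfl⟩ := ht
          obtain ⟨n, hn, m, hm, hxm, hm₁, hm₂⟩ :=
            step z₂ z₁ b a (by omega) h₂ h₁ x₂ t y₁ hx₂ hx₁ hy₂ hy₁
          exact ⟨n, by omega, m, hm, by simpa using hxm, hm₂, hm₁⟩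

/-- Languages covered from inside by monomials of bounded degree. -/
def IsMonoUnion {A : Type u} (c : Setoid (List A)) (L : Language A) : Prop :=
  ∃ N, ∀ x ∈ L, ∃ n ≤ N, ∃ m, IsMono c n m ∧ x ∈ m ∧ m ≤ L

theorem isMonoUnion_of_pol {A : Type u} {c : Setoid (List A)} {L : Language A}
    (h : PolClosure (satLang c) L) : IsMonoUnion c L := by
  induction h with
  | base hL => exact ⟨0, fun x hx => ⟨0, le_rfl, _, .base x, c.refl x, fun y hy => hL x y hy hx⟩⟩
  | sup _ _ ih₁ ih₂ =>
    obtain ⟨N₁, h₁⟩ := ih₁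
    obtain ⟨N₂, h₂⟩ := ih₂
    refine ⟨max N₁ N₂, ?_⟩
    rintro x (hx | hx)
    · obtain ⟨n, hn, m, hm, hxm, hle⟩ := h₁ x hx
      exact ⟨n, by omega, m, hm, hxm, hle.trans le_sup_left⟩
    · obtain ⟨n, hn, m, hm, hxm, hle⟩ := h₂ x hx
      exact ⟨n, by omega, m, hm, hxm, hle.trans le_sup_right⟩
  | marked a _ _ ih₁ ih₂ =>
    obtain ⟨N₁, h₁⟩ := ih₁
    obtain ⟨N₂, h₂⟩ := ih₂
    refine ⟨N₁ + N₂ + 1, ?_⟩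
    intro z hz
    obtain ⟨x, hx, y, hy, rfl⟩ := mem_marked.1 hz
    obtain ⟨n, hn, m, hm, hxm, hle⟩ := h₁ x hx
    obtain ⟨n', hn', m', hm', hym, hle'⟩ := h₂ y hy
    exact ⟨n + n' + 1, by omega, _, hm.marked a hm', mem_marked.2 ⟨x, hxm, y, hym, rfl⟩,
      mul_le_mul' (mul_le_mul' hle le_rfl) hle'⟩

theorem prop_of_eq {α : Type u} {p : α → Prop} {a b : α} (hb : p b) (h : a = b) : p a := h ▸ hb

theorem polClosure_sUnion {A : Type u} {D : Set (Language A)} (hD : ⊥ ∈ D)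
    {𝒮 : Set (Language A)} (h𝒮 : 𝒮.Finite) (h : ∀ m ∈ 𝒮, PolClosure D m) :
    PolClosure D {x | ∃ m ∈ 𝒮, x ∈ m} := by
  induction 𝒮, h𝒮 using Set.Finite.induction_on with
  | empty =>
    refine prop_of_eq (p := PolClosure D) (PolClosure.base hD) (Language.ext fun x => ⟨?_, ?_⟩)
    · rintro ⟨m, hm, -⟩
      exact hm.elim
    · exact fun hx => hx.elim
  | @insert m 𝒮 _ _ ih =>
    refine prop_of_eq (p := PolClosure D)
      (PolClosure.sup (h m (Set.mem_insert _ _)) (ih fun m' hm' => h m' (Or.inr hm')))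
      (Language.ext fun x => ⟨?_, ?_⟩)
    · rintro ⟨m', rfl | hm', hx⟩
      · exact Or.inl hx
      · exact Or.inr ⟨m', hm', hx⟩
    · rintro (hx | ⟨m', hm', hx⟩)
      · exact ⟨m, Or.inl rfl, hx⟩
      · exact ⟨m', Or.inr hm', hx⟩

theorem pol_of_isMono {A : Type u} {c : Setoid (List A)} {n : ℕ} {m : Language A}
    (h : IsMono c n m) : PolClosure (satLang c) m := by
  induction h with
  | base x => exact .base (up_zero_mem_satLang c x)
  | cons x a _ ih => exact .marked a (.base (up_zero_mem_satLang c x)) ih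

/-- Only finitely many monomials have bounded degree, so L is the finite union of those it contains.
-/
theorem pol_of_isMonoUnion {A : Type u} [Finite A] {c : Setoid (List A)} [Finite (Quotient c)]
    {L : Language A} (h : IsMonoUnion c L) : PolClosure (satLang c) L := by
  obtain ⟨N, hN⟩ := h
  have hfin : {m | (∃ n ≤ N, IsMono c n m) ∧ m ≤ L}.Finite := by
    refine (Set.Finite.biUnion (Set.finite_Iic N) fun n _ => finite_isMono c n).subset ?_
    rintro m ⟨⟨n, hn, hm⟩, -⟩
    exact Set.mem_biUnion hn hm
  have hbot : (⊥ : Language A) ∈ satLang c := fun _ _ _ hx => hx.elim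
  refine prop_of_eq (p := PolClosure (satLang c)) (polClosure_sUnion hbot hfin
    (by rintro m ⟨⟨n, -, hm⟩, -⟩; exact pol_of_isMono hm))
    (Language.ext fun x => ⟨fun hx => ?_, ?_⟩)
  · obtain ⟨n, hn, m, hm, hxm, hle⟩ := hN x hx
    exact ⟨m, ⟨⟨n, hn, hm⟩, hle⟩, hxm⟩
  · rintro ⟨m, ⟨-, hle⟩, hx⟩
    exact hle hx

/-- The polynomial closure of the saturated languages of a finite congruence is closed under
intersection. -/
theorem polClosure_inf {A : Type u} [Finite A] {c : Setoid (List A)} (hc : IsCong c)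
    [Finite (Quotient c)] {K L : Language A} (hK : PolClosure (satLang c) K)
    (hL : PolClosure (satLang c) L) : PolClosure (satLang c) (K ⊓ L) := by
  apply pol_of_isMonoUnion
  obtain ⟨N₁, h₁⟩ := isMonoUnion_of_pol hK
  obtain ⟨N₂, h₂⟩ := isMonoUnion_of_pol hL
  refine ⟨N₁ + N₂, ?_⟩
  rintro x ⟨hx₁, hx₂⟩
  obtain ⟨n₁, hn₁, m₁, hm₁, hxm₁, hle₁⟩ := h₁ x hx₁
  obtain ⟨n₂, hn₂, m₂, hm₂, hxm₂, hle₂⟩ := h₂ x hx₂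
  obtain ⟨n, hn, m, hm, hxm, hm₁', hm₂'⟩ := IsMono.refine_inf hc rfl hm₁ hm₂ x hxm₁ hxm₂
  exact ⟨n, by omega, m, hm, hxm, le_inf (hm₁'.trans hle₁) (hm₂'.trans hle₂)⟩

theorem polClosure_sInter {A : Type u} [Finite A] {c : Setoid (List A)} (hc : IsCong c)
    [Finite (Quotient c)] {𝒮 : Set (Language A)} (h𝒮 : 𝒮.Finite)
    (h : ∀ m ∈ 𝒮, PolClosure (satLang c) m) : PolClosure (satLang c) {x | ∀ m ∈ 𝒮, x ∈ m} := by
  induction 𝒮, h𝒮 using Set.Finite.induction_on with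
  | empty => exact .base fun _ _ _ _ _ hm => hm.elim
  | @insert m 𝒮 _ _ ih =>
    refine prop_of_eq (p := PolClosure (satLang c)) (polClosure_inf hc (h m (Set.mem_insert _ _))
      (ih fun m' hm' => h m' (Or.inr hm'))) (Language.ext fun x =>
        ⟨fun hx => ⟨hx m (Or.inl rfl), fun m' hm' => hx m' (Or.inr hm')⟩, ?_⟩)
    rintro ⟨h1, h2⟩ m' (rfl | hm')
    · exact h1
    · exact h2 m' hm'

/-- The game conditions on the decompositions of x are an intersection of marked products of lower
upsets, finitely many whatever the length of x. -/
theorem polClosure_up {A : Type u} [Finite A] {c : Setoid (List A)} (hc : IsCong c)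
    [Finite (Quotient c)] (n : ℕ) (x : List A) : PolClosure (satLang c) (up c n x) := by
  induction n generalizing x with
  | zero => exact .base (up_zero_mem_satLang c x)
  | succ n ih =>
    let 𝒮 : Set (Language A) :=
      {m | ∃ x₁ a x₂, x = x₁ ++ a :: x₂ ∧ m = up c n x₁ * {[a]} * up c n x₂}
    have hfin : 𝒮.Finite := by
      refine ((((finite_range_up c n).prod (Set.finite_univ (α := A))).prod
        (finite_range_up c n)).image (fun p => p.1.1 * {[p.1.2]} * p.2)).subset ?_
      rintro _ ⟨x₁, a, x₂, -, rfl⟩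
      exact ⟨((up c n x₁, a), up c n x₂), ⟨⟨⟨x₁, rfl⟩, trivial⟩, ⟨x₂, rfl⟩⟩, rfl⟩
    have h𝒮 : ∀ m ∈ 𝒮, PolClosure (satLang c) m := by
      rintro _ ⟨x₁, a, x₂, -, rfl⟩
      exact .marked a (ih x₁) (ih x₂)
    refine prop_of_eq (p := PolClosure (satLang c))
      (polClosure_inf hc (ih x) (polClosure_sInter hc hfin h𝒮)) (Language.ext fun z => ⟨?_, ?_⟩)
    · rintro ⟨h1, h2⟩
      refine ⟨h1, ?_⟩
      rintro _ ⟨x₁, a, x₂, hx, rfl⟩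
      obtain ⟨y₁, y₂, rfl, h₁, h₂⟩ := h2 x₁ a x₂ hx
      exact mem_marked.2 ⟨y₁, h₁, y₂, h₂, rfl⟩
    · rintro ⟨h1, h2⟩
      refine ⟨h1, fun x₁ a x₂ hx => ?_⟩
      obtain ⟨y₁, h₁, y₂, h₂, hz⟩ := mem_marked.1 (h2 _ ⟨x₁, a, x₂, hx, rfl⟩)
      exact ⟨y₁, y₂, hz, h₁, h₂⟩

/-! ### From Pol to PBPol: the two-layer stratification -/

/-- The equivalence associated with the `k`-th preorder. -/
def eqv {A : Type u} (c : Setoid (List A)) (k : ℕ) : Setoid (List A) where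
  r x y := pre c k x y ∧ pre c k y x
  iseqv := ⟨fun x => ⟨pre_refl c k x, pre_refl c k x⟩, fun h => ⟨h.2, h.1⟩,
    fun h h' => ⟨pre_trans h.1 h'.1, pre_trans h'.2 h.2⟩⟩

theorem isCong_eqv {A : Type u} {c : Setoid (List A)} (hc : IsCong c) (k : ℕ) :
    IsCong (eqv c k) := fun _ _ _ _ h h' => ⟨pre_append hc h.1 h'.1, pre_append hc h.2 h'.2⟩

theorem eqv_of_forall_up {A : Type u} {c : Setoid (List A)} {k : ℕ} {x y : List A}
    (h : ∀ P ∈ Set.range (up c k), x ∈ P ↔ y ∈ P) : eqv c k x y :=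
  ⟨(h _ ⟨x, rfl⟩).1 (pre_refl c k x), (h _ ⟨y, rfl⟩).2 (pre_refl c k y)⟩

theorem finite_quotient_eqv {A : Type u} [Finite A] (c : Setoid (List A)) [Finite (Quotient c)]
    (k : ℕ) : Finite (Quotient (eqv c k)) := by
  have := (finite_range_up c k).to_subtype
  have hlift : ∀ x y, eqv c k x y → up c k x = up c k y := fun x y h =>
    Language.ext fun z => ⟨fun hz => pre_trans h.2 hz, fun hz => pre_trans h.1 hz⟩
  refine Finite.of_injective (β := Set.range (up c k))
    (Quotient.lift (s := eqv c k) (fun x => ⟨up c k x, x, rfl⟩)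
      fun x y h => Subtype.ext (hlift x y h)) ?_
  intro p q
  induction p using Quotient.inductionOn with | _ x
  induction q using Quotient.inductionOn with | _ y
  intro h
  have h : up c k x = up c k y := congrArg Subtype.val h
  apply Quotient.sound
  refine ⟨?_, ?_⟩
  · have : y ∈ up c k y := pre_refl c k y
    rw [← h] at this
    exact this
  · have : x ∈ up c k x := pre_refl c k x
    rw [h] at this
    exact this

/-- L is a union of atoms of the finite family 𝒬. Induction peels off one P: inside P and inside its
complement, L agrees with a language determined by the remaining members. -/
theorem boolClosure_of_finite {A : Type u} {D : Set (Language A)} {𝒬 : Set (Language A)}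
    (hfin : 𝒬.Finite) (h𝒬 : ∀ P ∈ 𝒬, BoolClosure D P) {L : Language A}
    (hL : ∀ x y, (∀ P ∈ 𝒬, x ∈ P ↔ y ∈ P) → x ∈ L → y ∈ L) : BoolClosure D L := by
  induction 𝒬, hfin using Set.Finite.induction_on generalizing L with
  | empty =>
    by_cases h : ∃ x, x ∈ L
    · obtain ⟨x, hx⟩ := h
      exact prop_of_eq (p := BoolClosure D) .top (Language.ext fun y =>
        ⟨fun _ => trivial, fun _ => hL x y (fun P hP => hP.elim) hx⟩)
    · exact prop_of_eq (p := BoolClosure D) .bot (Language.ext fun y =>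
        ⟨fun hy => (h ⟨y, hy⟩).elim, fun hy => hy.elim⟩)
  | @insert P 𝒬 _ _ ih =>
    have key : ∀ Q : Language A,
        BoolClosure D {y | ∃ x ∈ L, x ∈ Q ∧ ∀ P ∈ 𝒬, x ∈ P ↔ y ∈ P} := by
      intro Q
      refine ih (fun P hP => h𝒬 P (Or.inr hP)) ?_
      rintro y z hyz ⟨x, hx, hxQ, hxy⟩
      exact ⟨x, hx, hxQ, fun P hP => (hxy P hP).trans (hyz P hP)⟩
    have hP := h𝒬 P (Or.inl rfl)
    refine prop_of_eq (p := BoolClosure D)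
      (.sup (.inf hP (key P)) (.inf (.compl hP) (key Pᶜ)))
      (Language.ext fun y => ⟨fun hy => ?_, ?_⟩)
    · by_cases hyP : y ∈ P
      · exact Or.inl ⟨hyP, y, hy, hyP, fun _ _ => Iff.rfl⟩
      · exact Or.inr ⟨hyP, y, hy, hyP, fun _ _ => Iff.rfl⟩
    · rintro (⟨hyP, x, hx, hxP, hxy⟩ | ⟨hyP, x, hx, hxP, hxy⟩)
      · refine hL x y ?_ hx
        rintro P' (rfl | hP')
        · exact ⟨fun _ => hyP, fun _ => hxP⟩
        · exact hxy P' hP'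
      · refine hL x y ?_ hx
        rintro P' (rfl | hP')
        · exact ⟨fun h => (hxP h).elim, fun h => (hyP h).elim⟩
        · exact hxy P' hP'

theorem polClosure_mono {A : Type u} {D D' : Set (Language A)} (h : D ⊆ D') {L : Language A}
    (hL : PolClosure D L) : PolClosure D' L := by
  induction hL with
  | base hL => exact .base (h hL)
  | sup _ _ ih₁ ih₂ => exact .sup ih₁ ih₂
  | marked a _ _ ih₁ ih₂ => exact .marked a ih₁ ih₂

theorem isCong_canonicalSetoid {A : Type u} {C : Set (Language A)}
    (hC : IsQuotientingBooleanAlgebra C) : IsCong (canonicalSetoid C) := by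
  intro x x' y y' hx hy L hL
  exact (hx _ (hC.rightQuotient_mem L hL y)).trans (hy _ (hC.leftQuotient_mem L hL x'))

theorem finite_quotient_canonicalSetoid {A : Type u} {C : Set (Language A)} (hC : C.Finite) :
    Finite (Quotient (canonicalSetoid C)) := by
  have := hC.to_subtype
  refine Finite.of_injective (β := Set C)
    (Quotient.lift (s := canonicalSetoid C) (fun x => {L | x ∈ L.1}) fun x y h => ?_) ?_
  · ext L
    exact h L.1 L.2
  · intro p q
    induction p using Quotient.inductionOn with | _ x
    induction q using Quotient.inductionOn with | _ y
    intro h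
    apply Quotient.sound
    intro L hL
    exact Set.ext_iff.1 h ⟨L, hL⟩

theorem satLang_canonicalSetoid_subset {A : Type u} {C : Set (Language A)}
    (hC : IsQuotientingBooleanAlgebra C) (hfin : C.Finite) : satLang (canonicalSetoid C) ⊆ C := by
  intro L hL
  have h : BoolClosure C L := boolClosure_of_finite hfin (fun P hP => .base hP)
    fun x y h hx => hL x y h hx
  clear hL
  induction h with
  | base h => exact h
  | bot => exact hC.bot_mem
  | top => exact hC.top_mem
  | sup _ _ h₁ h₂ => exact hC.sup_mem _ h₁ _ h₂
  | inf _ _ h₁ h₂ => exact hC.inf_mem _ h₁ _ h₂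
  | compl _ h => exact hC.compl_mem _ h

/-- The `j`-th preorder of the stratification of `PBPol`. -/
def fine {A : Type u} (c : Setoid (List A)) (j : ℕ) : List A → List A → Prop := pre (eqv c j) j

/-- The words above `x` in the `j`-th preorder of the stratification of `PBPol`. -/
def fineUp {A : Type u} (c : Setoid (List A)) (j : ℕ) (x : List A) : Language A :=
  {y | fine c j x y}

theorem eqv_of_le {A : Type u} {c : Setoid (List A)} {i j : ℕ} (hij : i ≤ j) {x y : List A}
    (h : eqv c j x y) : eqv c i x y := ⟨pre_of_le hij h.1, pre_of_le hij h.2⟩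

theorem fine_refl {A : Type u} (c : Setoid (List A)) (j : ℕ) (x : List A) : fine c j x x :=
  pre_refl _ _ _

theorem fine_trans {A : Type u} {c : Setoid (List A)} {j : ℕ} {x y z : List A}
    (h : fine c j x y) (h' : fine c j y z) : fine c j x z := pre_trans h h'

theorem fine_of_le {A : Type u} {c : Setoid (List A)} {i j : ℕ} (hij : i ≤ j) {x y : List A}
    (h : fine c j x y) : fine c i x y :=
  pre_of_le hij (pre_setoid_mono (fun _ _ => eqv_of_le hij) h)

theorem fine_append {A : Type u} {c : Setoid (List A)} (hc : IsCong c) {j : ℕ}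
    {x x' y y' : List A} (hx : fine c j x x') (hy : fine c j y y') :
    fine c j (x ++ y) (x' ++ y') := pre_append (isCong_eqv hc j) hx hy

theorem fine_split {A : Type u} {c : Setoid (List A)} (hc : IsCong c) {j : ℕ}
    {x y z : List A} (h : fine c (j + 1) (x ++ y) z) :
    ∃ z₁ z₂, z = z₁ ++ z₂ ∧ fine c j x z₁ ∧ fine c j y z₂ :=
  pre_split (isCong_eqv hc j)
    (pre_setoid_mono (fun _ _ => eqv_of_le (Nat.le_succ j)) h : pre (eqv c j) (j + 1) _ _)

theorem eqv_of_fine {A : Type u} {c : Setoid (List A)} {j : ℕ} {x y : List A}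
    (h : fine c j x y) : eqv c j x y := pre_of_le (Nat.zero_le j) h

/-- `eqv c j` compares in both directions, so a letter of x would have to be matched in the empty
word. -/
theorem eq_nil_of_fine {A : Type u} {c : Setoid (List A)} {j : ℕ} (hj : 1 ≤ j) {x : List A}
    (h : fine c j [] x) : x = [] := by
  have h : pre c 1 x [] := pre_of_le hj (eqv_of_fine h).2
  rcases x with _ | ⟨a, x⟩
  · rfl
  · obtain ⟨y₁, y₂, hy, -⟩ := h.2 [] a x rfl
    simp at hy

/-- One round finds the letter a; the level left over, at least 1, forces both sides to be empty. -/
theorem eq_letter_of_fine {A : Type u} {c : Setoid (List A)} {j : ℕ} (hj : 2 ≤ j) {x : List A}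
    {a : A} (h : fine c j [a] x) : x = [a] := by
  obtain ⟨j, rfl⟩ : ∃ i, j = i + 1 := ⟨j - 1, by omega⟩
  obtain ⟨y₁, y₂, rfl, h₁, h₂⟩ := h.2 [] a [] rfl
  have h₁ : fine c j [] y₁ := pre_setoid_mono (fun _ _ => eqv_of_le (Nat.le_succ j)) h₁
  have h₂ : fine c j [] y₂ := pre_setoid_mono (fun _ _ => eqv_of_le (Nat.le_succ j)) h₂
  rw [eq_nil_of_fine (by omega) h₁, eq_nil_of_fine (by omega) h₂]
  rfl

theorem exists_pre_upset_of_pol {A : Type u} {C : Set (Language A)} {L : Language A}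
    (hL : PolClosure C L) :
    ∃ n, ∀ x y, pre (canonicalSetoid C) n x y → x ∈ L → y ∈ L := by
  induction hL with
  | @base L hL => exact ⟨0, fun x y h hx => (h L hL).1 hx⟩
  | sup _ _ ih₁ ih₂ =>
    obtain ⟨n₁, h₁⟩ := ih₁
    obtain ⟨n₂, h₂⟩ := ih₂
    refine ⟨max n₁ n₂, fun x y h hx => ?_⟩
    rcases hx with hx | hx
    · exact Or.inl (h₁ x y (pre_of_le (le_max_left _ _) h) hx)
    · exact Or.inr (h₂ x y (pre_of_le (le_max_right _ _) h) hx)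
  | marked a _ _ ih₁ ih₂ =>
    obtain ⟨n₁, h₁⟩ := ih₁
    obtain ⟨n₂, h₂⟩ := ih₂
    refine ⟨max n₁ n₂ + 1, fun x y h hx => ?_⟩
    obtain ⟨x₁, hx₁, x₂, hx₂, rfl⟩ := mem_marked.1 hx
    obtain ⟨y₁, y₂, rfl, h₃, h₄⟩ := h.2 _ _ _ rfl
    exact mem_marked.2 ⟨y₁, h₁ _ _ (pre_of_le (le_max_left _ _) h₃) hx₁, y₂,
      h₂ _ _ (pre_of_le (le_max_right _ _) h₄) hx₂, rfl⟩

theorem exists_mem_satLang_of_boolPol {A : Type u} {C : Set (Language A)} {L : Language A}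
    (hL : BoolClosure (PolClosure C) L) : ∃ k, L ∈ satLang (eqv (canonicalSetoid C) k) := by
  induction hL with
  | base hL =>
    obtain ⟨n, hn⟩ := exists_pre_upset_of_pol hL
    exact ⟨n, fun x y h => hn x y h.1⟩
  | bot => exact ⟨0, fun _ _ _ hx => hx.elim⟩
  | top => exact ⟨0, fun _ _ _ _ => trivial⟩
  | sup _ _ ih₁ ih₂ =>
    obtain ⟨n₁, h₁⟩ := ih₁
    obtain ⟨n₂, h₂⟩ := ih₂
    refine ⟨max n₁ n₂, fun x y h hx => ?_⟩
    rcases hx with hx | hx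
    · exact Or.inl (h₁ x y (eqv_of_le (le_max_left _ _) h) hx)
    · exact Or.inr (h₂ x y (eqv_of_le (le_max_right _ _) h) hx)
  | inf _ _ ih₁ ih₂ =>
    obtain ⟨n₁, h₁⟩ := ih₁
    obtain ⟨n₂, h₂⟩ := ih₂
    refine ⟨max n₁ n₂, fun x y h hx => ?_⟩
    exact ⟨h₁ x y (eqv_of_le (le_max_left _ _) h) hx.1,
      h₂ x y (eqv_of_le (le_max_right _ _) h) hx.2⟩
  | compl _ ih =>
    obtain ⟨n, hn⟩ := ih
    exact ⟨n, fun x y h hx hy => hx (hn y x ⟨h.2, h.1⟩ hy)⟩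

/-- Every language of `PBPol(C)` is an upset for some level of the stratification. -/
theorem exists_fine_upset_of_pbpol {A : Type u} {C : Set (Language A)} {L : Language A}
    (hL : L ∈ PBPolClosure C) :
    ∃ j, ∀ x y, fine (canonicalSetoid C) j x y → x ∈ L → y ∈ L := by
  change PolClosure _ L at hL
  induction hL with
  | base hL =>
    obtain ⟨k, hk⟩ := exists_mem_satLang_of_boolPol hL
    exact ⟨k, fun x y h => hk x y (eqv_of_fine h)⟩
  | sup _ _ ih₁ ih₂ =>
    obtain ⟨n₁, h₁⟩ := ih₁
    obtain ⟨n₂, h₂⟩ := ih₂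
    refine ⟨max n₁ n₂, fun x y h hx => ?_⟩
    rcases hx with hx | hx
    · exact Or.inl (h₁ x y (fine_of_le (le_max_left _ _) h) hx)
    · exact Or.inr (h₂ x y (fine_of_le (le_max_right _ _) h) hx)
  | marked a _ _ ih₁ ih₂ =>
    obtain ⟨n₁, h₁⟩ := ih₁
    obtain ⟨n₂, h₂⟩ := ih₂
    refine ⟨max n₁ n₂ + 1, fun x y h hx => ?_⟩
    obtain ⟨x₁, hx₁, x₂, hx₂, rfl⟩ := mem_marked.1 hx
    obtain ⟨y₁, y₂, rfl, h₃, h₄⟩ := h.2 _ _ _ rfl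
    have h₃ : fine (canonicalSetoid C) (max n₁ n₂) x₁ y₁ :=
      pre_setoid_mono (fun _ _ => eqv_of_le (Nat.le_succ _)) h₃
    have h₄ : fine (canonicalSetoid C) (max n₁ n₂) x₂ y₂ :=
      pre_setoid_mono (fun _ _ => eqv_of_le (Nat.le_succ _)) h₄
    exact mem_marked.2 ⟨y₁, h₁ _ _ (fine_of_le (le_max_left _ _) h₃) hx₁, y₂,
      h₂ _ _ (fine_of_le (le_max_right _ _) h₄) hx₂, rfl⟩

theorem finite_range_fineUp {A : Type u} [Finite A] {C : Set (Language A)} (hfin : C.Finite)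
    (j : ℕ) : (Set.range (fineUp (canonicalSetoid C) j)).Finite := by
  have := finite_quotient_canonicalSetoid hfin
  have := finite_quotient_eqv (canonicalSetoid C) j
  exact finite_range_up (eqv (canonicalSetoid C) j) j

/-- The upset is in Pol of the `eqv c j`-saturated languages, and these are Boolean combinations of
the finitely many `up c j x`, which are in Pol(C). -/
theorem fineUp_mem_pbpol {A : Type u} [Finite A] {C : Set (Language A)}
    (hC : IsQuotientingBooleanAlgebra C) (hfin : C.Finite) (j : ℕ) (x : List A) :
    fineUp (canonicalSetoid C) j x ∈ PBPolClosure C := by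
  have := finite_quotient_canonicalSetoid hfin
  have := finite_quotient_eqv (canonicalSetoid C) j
  have hc := isCong_canonicalSetoid hC
  refine polClosure_mono ?_ (polClosure_up (isCong_eqv hc j) j x)
  intro L hL
  refine boolClosure_of_finite (finite_range_up (canonicalSetoid C) j) ?_
    fun x y h hx => hL x y (eqv_of_forall_up h) hx
  rintro _ ⟨x, rfl⟩
  exact .base (polClosure_mono (satLang_canonicalSetoid_subset hC hfin) (polClosure_up hc j x))

/-! ### Pointed imprints along the stratification -/

theorem hle_refl {R : Type w} [Add R] (hR : ∀ r : R, r + r = r) (r : R) : HLe r r := hR r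

theorem hle_trans {R : Type w} [AddSemigroup R] {r s t : R} (h : HLe r s) (h' : HLe s t) :
    HLe r t := by
  unfold HLe at *
  rw [← h', add_assoc, h]

theorem hle_mul {R : Type w} [NonUnitalSemiring R] (hR : ∀ r : R, r + r = r) {r r' s s' : R}
    (h : HLe r r') (h' : HLe s s') : HLe (r * s) (r' * s') := by
  unfold HLe at *
  have : r' * s' = r' * s' + r' * s + (r * s' + r * s) := by
    conv_lhs => rw [← h, ← h', add_mul, mul_add, mul_add]
  rw [this]
  simp only [add_assoc, hR]

theorem hle_add_left {R : Type w} [NonUnitalSemiring R] (hR : ∀ r : R, r + r = r) (r s : R) :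
    HLe r (r + s) := by
  unfold HLe
  rw [add_comm, ← add_assoc, hR]

theorem hle_add_right {R : Type w} [NonUnitalSemiring R] (hR : ∀ r : R, r + r = r) (r s : R) :
    HLe s (r + s) := by
  rw [add_comm]
  exact hle_add_left hR s r

theorem add_hle {R : Type w} [NonUnitalSemiring R] {r s t : R} (h : HLe r t) (h' : HLe s t) :
    HLe (r + s) t := by
  unfold HLe at *
  rw [← add_assoc, h, h']

theorem map_hle_map {A : Type u} {R : Type w} [NonUnitalSemiring R] (ρ : Language A →ₙ+* R)
    {K L : Language A} (h : K ≤ L) : HLe (ρ K) (ρ L) := by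
  unfold HLe
  rw [← map_add]
  congr 1
  exact sup_eq_left.2 h

theorem map_append_singleton {A : Type u} {R : Type w} [NonUnitalSemiring R]
    (ρ : Language A →ₙ+* R) (x y : List A) : ρ {x ++ y} = ρ {x} * ρ {y} := by
  rw [← map_mul]
  congr 1
  refine Language.ext fun z => ⟨?_, fun h => ?_⟩
  · rintro rfl
    exact Language.append_mem_mul rfl rfl
  · obtain ⟨x', rfl, y', rfl, rfl⟩ := Language.mem_mul.1 h
    rfl

theorem map_mul_map_nil {A : Type u} {R : Type w} [NonUnitalSemiring R]
    (ρ : Language A →ₙ+* R) (K : Language A) : ρ K * ρ {[]} = ρ K := by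
  rw [← map_mul]
  exact congrArg ρ (mul_one K)

theorem map_nil_mul_map {A : Type u} {R : Type w} [NonUnitalSemiring R]
    (ρ : Language A →ₙ+* R) (K : Language A) : ρ {[]} * ρ K = ρ K := by
  rw [← map_mul]
  exact congrArg ρ (one_mul K)

/-- The value of a word under a morphism defined on the free monoid. -/
def val {A : Type u} {M : Type v} [Monoid M] (α : FreeMonoid A →* M) (x : List A) : M :=
  α (FreeMonoid.ofList x)

@[simp] theorem val_nil {A : Type u} {M : Type v} [Monoid M] (α : FreeMonoid A →* M) :
    val α [] = 1 := map_one α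

@[simp] theorem val_append {A : Type u} {M : Type v} [Monoid M] (α : FreeMonoid A →* M)
    (x y : List A) : val α (x ++ y) = val α x * val α y := by
  unfold val
  rw [FreeMonoid.ofList_append, map_mul]

theorem fineUp_anti {A : Type u} {c : Setoid (List A)} {i j : ℕ} (hij : i ≤ j) (x : List A) :
    fineUp c j x ≤ fineUp c i x := fun _ h => fine_of_le hij h

theorem fineUp_mul_le {A : Type u} {c : Setoid (List A)} (hc : IsCong c) (j : ℕ) (x y : List A) :
    fineUp c j x * fineUp c j y ≤ fineUp c j (x ++ y) := by
  intro z hz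
  obtain ⟨x', hx, y', hy, rfl⟩ := Language.mem_mul.1 hz
  exact fine_append hc hx hy

theorem fineUp_append_le {A : Type u} {c : Setoid (List A)} (hc : IsCong c) (j : ℕ)
    (x y : List A) : fineUp c (j + 1) (x ++ y) ≤ fineUp c j x * fineUp c j y := by
  intro z hz
  obtain ⟨z₁, z₂, rfl, h₁, h₂⟩ := fine_split hc hz
  exact Language.append_mem_mul h₁ h₂

/-- The pointed imprint on `X` that is optimal for all levels of the stratification of `PBPol`. -/
def tau {A : Type u} {M : Type v} {R : Type w} [Monoid M] [NonUnitalSemiring R]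
    (c : Setoid (List A)) (α : FreeMonoid A →* M) (ρ : Language A →ₙ+* R) (X : Language A) :
    Set (M × R) :=
  {p | ∀ j, ∃ x ∈ X, val α x = p.1 ∧ HLe p.2 (ρ (fineUp c j x))}

section

variable {A : Type u} {M : Type v} {R : Type w} [Monoid M] [NonUnitalSemiring R]
  {c : Setoid (List A)} {α : FreeMonoid A →* M} {ρ : Language A →ₙ+* R}

theorem tau_mono {X Y : Language A} (h : X ≤ Y) : tau c α ρ X ⊆ tau c α ρ Y := by
  intro p hp j
  obtain ⟨x, hx, hp⟩ := hp j
  exact ⟨x, h hx, hp⟩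

theorem tau_down {X : Language A} {s : M} {r r' : R} (h : (s, r) ∈ tau c α ρ X) (hr : HLe r' r) :
    (s, r') ∈ tau c α ρ X := by
  intro j
  obtain ⟨x, hx, hs, hp⟩ := h j
  exact ⟨x, hx, hs, hle_trans hr hp⟩

/-- Some level of the stratification realizes the optimal pointed imprint. -/
theorem exists_tau_level (c : Setoid (List A)) (α : FreeMonoid A →* M) (ρ : Language A →ₙ+* R)
    [Finite M] [Finite R] (X : Language A) :
    ∃ j, ∀ i ≥ j, ∀ x ∈ X, (val α x, ρ (fineUp c i x)) ∈ tau c α ρ X := by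
  -- Each pair outside `tau` is refuted at some level, and at all later ones. There are finitely
  -- many pairs, so one level refutes them all.
  have h : ∀ p : M × R, ∃ j, p ∉ tau c α ρ X → ∀ x ∈ X, val α x = p.1 →
      ¬ HLe p.2 (ρ (fineUp c j x)) := by
    intro p
    by_cases hp : p ∈ tau c α ρ X
    · exact ⟨0, fun h => (h hp).elim⟩
    · have hp' := hp
      simp only [tau, Set.mem_ofPred_eq, not_forall, not_exists, not_and] at hp'
      obtain ⟨j, hj⟩ := hp'
      exact ⟨j, fun _ => hj⟩
  choose f hf using h
  obtain ⟨J, hJ⟩ := (Set.finite_range f).bddAbove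
  refine ⟨J, fun i hi x hx => ?_⟩
  by_contra hn
  exact hf _ hn x hx rfl (map_hle_map ρ (fineUp_anti (le_trans (hJ ⟨_, rfl⟩) hi) x))

theorem dmul_tau_subset (hR : ∀ r : R, r + r = r) (hc : IsCong c) (X Y : Language A) :
    dmul (tau c α ρ X) (tau c α ρ Y) ⊆ tau c α ρ (X * Y) := by
  rintro ⟨s, r⟩ ⟨p₁, h₁, p₂, h₂, hs, hr⟩ j
  obtain ⟨x, hx, hxs, hxr⟩ := h₁ j
  obtain ⟨y, hy, hys, hyr⟩ := h₂ j
  refine ⟨x ++ y, Language.append_mem_mul hx hy, ?_, ?_⟩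
  · rw [val_append, hxs, hys, hs]
  · refine hle_trans hr (hle_trans (hle_mul hR hxr hyr) ?_)
    rw [← map_mul]
    exact map_hle_map ρ (fineUp_mul_le hc j x y)

/-- Splitting costs one level, so the pair is realized one level above a level where both factors
have stabilized. -/
theorem tau_mul_subset [Finite M] [Finite R] (hc : IsCong c) (X Y : Language A) :
    tau c α ρ (X * Y) ⊆ dmul (tau c α ρ X) (tau c α ρ Y) := by
  obtain ⟨j₁, h₁⟩ := exists_tau_level c α ρ X
  obtain ⟨j₂, h₂⟩ := exists_tau_level c α ρ Y
  intro p hp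
  obtain ⟨z, hz, hs, hr⟩ := hp (max j₁ j₂ + 1)
  obtain ⟨x, hx, y, hy, rfl⟩ := Language.mem_mul.1 hz
  refine ⟨_, h₁ (max j₁ j₂) (le_max_left _ _) x hx, _, h₂ (max j₁ j₂) (le_max_right _ _) y hy,
    ?_, ?_⟩
  · rw [← hs, val_append]
  · refine hle_trans hr ?_
    rw [← map_mul]
    exact map_hle_map ρ (fineUp_append_le hc _ x y)

end

/-- The optimal pointed imprint for `PBPol(C)` is computed along the stratification. -/
theorem pointedOptImprint_eq_tau {A : Type u} {M : Type v} {R : Type w} [Finite A] [Monoid M]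
    [Finite M] [NonUnitalSemiring R] [Finite R] {C : Set (Language A)}
    (hC : IsQuotientingBooleanAlgebra C) (hfin : C.Finite) (α : FreeMonoid A →* M)
    (ρ : Language A →ₙ+* R) :
    pointedOptImprint (PBPolClosure C) α ρ = tau (canonicalSetoid C) α ρ ⊤ := by
  set c := canonicalSetoid C
  have hcover : ∀ s j, IsCover (PBPolClosure C) (fiber α s) (fineUp c j '' fiber α s) := by
    intro s j
    refine ⟨(finite_range_fineUp hfin j).subset (Set.image_subset_range _ _), ?_, ?_⟩
    · rintro _ ⟨x, -, rfl⟩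
      exact fineUp_mem_pbpol hC hfin j x
    · intro x hx
      exact ⟨_, ⟨x, hx, rfl⟩, fine_refl c j x⟩
  ext ⟨s, r⟩
  constructor
  · rintro ⟨𝒦, ⟨-, hopt⟩, hr⟩ j
    obtain ⟨_, ⟨x, hx, rfl⟩, hr'⟩ := hopt _ (hcover s j) hr
    exact ⟨x, trivial, hx, hr'⟩
  · intro h
    obtain ⟨j, hj⟩ := exists_tau_level c α ρ ⊤
    refine ⟨_, ⟨hcover s j, ?_⟩, ?_⟩
    · rintro 𝒦 ⟨hfin𝒦, hD, hcov⟩ r' ⟨_, ⟨x, hx, rfl⟩, hr'⟩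
      have hup : ∃ i, ∀ K ∈ 𝒦, ∀ x y, fine c i x y → x ∈ K → y ∈ K := by
        clear hcov
        induction 𝒦, hfin𝒦 using Set.Finite.induction_on with
        | empty => exact ⟨0, fun K hK => hK.elim⟩
        | @insert K 𝒦 _ _ ih =>
          obtain ⟨i₁, h₁⟩ := exists_fine_upset_of_pbpol (hD (Set.mem_insert _ _))
          obtain ⟨i₂, h₂⟩ := ih fun K hK => hD (Or.inr hK)
          refine ⟨max i₁ i₂, ?_⟩
          rintro K' (rfl | hK') x y hxy
          · exact h₁ x y (fine_of_le (le_max_left _ _) hxy)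
          · exact h₂ K' hK' x y (fine_of_le (le_max_right _ _) hxy)
      obtain ⟨i, hi⟩ := hup
      -- Stabilization at j replaces x by some y in the same fiber whose upset at level i has at
      -- least as large an image. The member of the cover containing y is an upset at level i, so it
      -- contains that upset.
      obtain ⟨y, -, hys, hyr⟩ := hj j le_rfl x trivial i
      obtain ⟨K, hK, hyK⟩ := hcov y (show val α y = s from hys.trans hx)
      exact ⟨K, hK, hle_trans hr'
        (hle_trans hyr (map_hle_map ρ fun z hz => hi K hK y z hz hyK))⟩
    · obtain ⟨x, -, hxs, hxr⟩ := h j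
      exact ⟨_, ⟨x, hxs, rfl⟩, hxr⟩

/-! ### Pumping and soundness -/

/-- The power of a word. -/
def pw {A : Type u} (x : List A) (n : ℕ) : List A := (List.replicate n x).flatten

@[simp] theorem pw_zero {A : Type u} (x : List A) : pw x 0 = [] := rfl

theorem pw_succ {A : Type u} (x : List A) (n : ℕ) : pw x (n + 1) = x ++ pw x n := by
  simp [pw, List.replicate_succ]

@[simp] theorem pw_one {A : Type u} (x : List A) : pw x 1 = x := by simp [pw]

theorem pw_add {A : Type u} (x : List A) (m n : ℕ) : pw x (m + n) = pw x m ++ pw x n := by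
  rw [pw, List.replicate_add, List.flatten_append]
  rfl

theorem pw_split {A : Type u} {x y z : List A} {a : A} {n : ℕ} (h : pw x n = y ++ a :: z) :
    ∃ i l p q, i + l + 1 = n ∧ x = p ++ a :: q ∧ y = pw x i ++ p ∧ z = q ++ pw x l := by
  induction n generalizing y with
  | zero => simp at h
  | succ n ih =>
    rw [pw_succ] at h
    rcases List.append_eq_append_iff.1 h with ⟨t, rfl, ht⟩ | ⟨t, hx, ht⟩
    · obtain ⟨i, l, p, q, hn, hx, hy, hz⟩ := ih ht
      exact ⟨i + 1, l, p, q, by omega, hx, by rw [hy, pw_succ, List.append_assoc], hz⟩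
    · rcases t with _ | ⟨b, t⟩
      · obtain ⟨i, l, p, q, hn, hx', hy, hz⟩ := ih (y := []) ht.symm
        refine ⟨i + 1, l, p, q, by omega, hx', ?_, hz⟩
        rw [pw_succ, List.append_assoc, ← hy, hx]
        simp
      · rw [List.cons_append, List.cons.injEq] at ht
        obtain ⟨rfl, rfl⟩ := ht
        exact ⟨0, n, y, t, by omega, hx, by simp, rfl⟩

theorem pw_cong {A : Type u} {c : Setoid (List A)} (hc : IsCong c) {x : List A}
    (hx : c (x ++ x) x) {n : ℕ} (hn : 1 ≤ n) : c (pw x n) x := by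
  induction n, hn using Nat.le_induction with
  | base => rw [pw_one]
  | succ n _ ih =>
    rw [pw_succ]
    exact c.trans (hc _ _ _ _ (c.refl x) ih) hx

/-- Inserting a word of the same type into a large power of a word of idempotent type goes up. -/
theorem exists_pump {A : Type u} {c : Setoid (List A)} (hc : IsCong c) {x : List A}
    (hx : c (x ++ x) x) (k : ℕ) : ∃ N, 1 ≤ N ∧ ∀ n ≥ N, ∀ i ≥ N, ∀ l ≥ N, ∀ y, c x y →
      pre c k (pw x n) (pw x i ++ y ++ pw x l) := by
  induction k with
  | zero =>
    refine ⟨1, le_rfl, fun n hn i hi l hl y hy => ?_⟩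
    have h1 : c (pw x i ++ y ++ pw x l) (x ++ x ++ x) :=
      hc _ _ _ _ (hc _ _ _ _ (pw_cong hc hx hi) (c.symm hy)) (pw_cong hc hx hl)
    have h2 : c (x ++ x ++ x) x := c.trans (hc _ _ _ _ hx (c.refl x)) hx
    exact c.trans (pw_cong hc hx hn) (c.symm (c.trans h1 h2))
  | succ k ih =>
    obtain ⟨N, hN1, hN⟩ := ih
    have hpw : ∀ n ≥ N, ∀ m ≥ 2 * N + 1, pre c k (pw x n) (pw x m) := by
      intro n hn m hm
      have := hN n hn N le_rfl (m - N - 1) (by omega) x (c.refl x)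
      have h2 : pw x m = pw x N ++ x ++ pw x (m - N - 1) := by
        conv_lhs => rw [show m = N + 1 + (m - N - 1) by omega, pw_add, pw_add, pw_one]
      rwa [h2]
    -- The marked letter lies in a copy of x with i' copies before it and l' after. If l' is small,
    -- it is matched in the right block with l' copies after it, and y is inserted on its left.
    -- Otherwise it is matched in the left block with min(i', 2N + 1) copies before it, and y is
    -- inserted on its right. The bound 4N + 4 leaves at least N copies wherever the induction
    -- hypothesis is used.
    refine ⟨4 * N + 4, by omega, fun n hn i hi l hl y hy =>
      ⟨hN n (by omega) i (by omega) l (by omega) y hy, ?_⟩⟩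
    intro z a z' hz
    obtain ⟨i', l', p, q, hsum, hxpq, rfl, rfl⟩ := pw_split hz
    by_cases hl' : l' < 2 * N + 1
    · refine ⟨pw x i ++ y ++ pw x (l - 1 - l') ++ p, q ++ pw x l', ?_, ?_, pre_refl _ _ _⟩
      · have : pw x l = pw x (l - 1 - l') ++ (p ++ a :: q) ++ pw x l' := by
          conv_lhs => rw [show l = l - 1 - l' + 1 + l' by omega, pw_add, pw_add, pw_one]
          rw [← hxpq]
        rw [this]
        simp
      · exact pre_append hc (hN _ (by omega) _ (by omega) _ (by omega) y hy) (pre_refl _ _ _)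
    · let m := min i' (2 * N + 1)
      have hm : m ≤ 2 * N + 1 := min_le_right _ _
      refine ⟨pw x m ++ p, q ++ (pw x (i - 1 - m) ++ y ++ pw x l), ?_, ?_, ?_⟩
      · have : pw x i = pw x m ++ (p ++ a :: q) ++ pw x (i - 1 - m) := by
          conv_lhs => rw [show i = m + 1 + (i - 1 - m) by omega, pw_add, pw_add, pw_one]
          rw [← hxpq]
        rw [this]
        simp
      · refine pre_append hc ?_ (pre_refl _ _ _)
        by_cases hi' : i' ≤ 2 * N + 1
        · rw [show m = i' from min_eq_left hi']
          exact pre_refl _ _ _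
        · rw [show m = 2 * N + 1 from min_eq_right (by omega)]
          exact hpw _ (by omega) _ le_rfl
      · exact pre_append hc (pre_refl _ _ _) (hN _ (by omega) _ (by omega) _ (by omega) y hy)

theorem val_pw {A : Type u} {M : Type v} [Monoid M] (α : FreeMonoid A →* M) {x : List A} {e : M}
    (he : e * e = e) (hx : val α x = e) {n : ℕ} (hn : 1 ≤ n) : val α (pw x n) = e := by
  induction n, hn using Nat.le_induction with
  | base => rw [pw_one, hx]
  | succ n _ ih => rw [pw_succ, val_append, hx, ih, he]

theorem hle_fineUp_pw {A : Type u} {R : Type w} [NonUnitalSemiring R]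
    (hR : ∀ r : R, r + r = r) {c : Setoid (List A)} (hc : IsCong c) {ρ : Language A →ₙ+* R}
    {x : List A} {f : R} (hf : f * f = f) {j : ℕ} (hx : HLe f (ρ (fineUp c j x))) {n : ℕ}
    (hn : 1 ≤ n) : HLe f (ρ (fineUp c j (pw x n))) := by
  induction n, hn using Nat.le_induction with
  | base => rwa [pw_one]
  | succ n _ ih =>
    have := hle_mul hR hx ih
    rw [hf, ← map_mul] at this
    rw [pw_succ]
    exact hle_trans this (map_hle_map ρ (fineUp_mul_le hc j _ _))

theorem dmul_mono {M : Type v} {R : Type w} [Monoid M] [NonUnitalSemiring R]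
    {T₁ T₁' T₂ T₂' : Set (M × R)} (h₁ : T₁ ⊆ T₁') (h₂ : T₂ ⊆ T₂') : dmul T₁ T₂ ⊆ dmul T₁' T₂' := by
  rintro p ⟨p₁, hp₁, p₂, hp₂, h⟩
  exact ⟨p₁, h₁ hp₁, p₂, h₂ hp₂, h⟩

section

variable {A : Type u} {M : Type v} {R : Type w} [Monoid M] [NonUnitalSemiring R]
  {C : Set (Language A)} {α : FreeMonoid A →* M} {tM : M → CType C} {ρ : Language A →ₙ+* R}
  {tR : R → CType C}

theorem cong_of_val_eq (hα : IsMorphismTypeMap C α tM) {x y : List A} (h : val α x = val α y) :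
    canonicalSetoid C x y := by
  apply Quotient.exact
  exact (hα _ x rfl).trans (hα _ y h.symm).symm

theorem cong_of_map_eq (hρ : IsRatingTypeMap C ρ tR) {x y : List A} (h : ρ {x} = ρ {y}) :
    canonicalSetoid C x y := by
  apply Quotient.exact
  exact (hρ _ x rfl).trans (hρ _ y h.symm).symm

/-- The operation producing elements of the pointed imprint from nested elements is sound. -/
theorem mem_tau_of_nested (hR : ∀ r : R, r + r = r) (hc : IsCong (canonicalSetoid C))
    (hα : IsMorphismTypeMap C α tM) {r f : R} {e : M} (he : e * e = e) (hf : f * f = f)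
    (h : ∀ k, ∃ x, ρ {x} = r ∧ (e, f) ∈ tau (canonicalSetoid C) α ρ (up (canonicalSetoid C) k x)) :
    (e, f * (r + ρ {[]}) * f) ∈ tau (canonicalSetoid C) α ρ ⊤ := by
  set c := canonicalSetoid C
  intro j
  obtain ⟨x, rfl, hx⟩ := h j
  obtain ⟨y, hxy, hye, hyf⟩ := hx j
  change val α y = e at hye
  change HLe f (ρ (fineUp c j y)) at hyf
  have hyy : c (y ++ y) y := cong_of_val_eq hα (by rw [val_append, hye, he])
  have hyx : c y x := c.symm (pre_of_le (Nat.zero_le j) hxy)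
  obtain ⟨N, hN1, hN⟩ := exists_pump hc hyy j
  have hpw : ∀ n ≥ N, ∀ m ≥ 2 * N + 1, pre c j (pw y n) (pw y m) := by
    intro n hn m hm
    have := hN n hn N le_rfl (m - N - 1) (by omega) y (c.refl y)
    have h2 : pw y m = pw y N ++ y ++ pw y (m - N - 1) := by
      conv_lhs => rw [show m = N + 1 + (m - N - 1) by omega, pw_add, pw_add, pw_one]
    rwa [h2]
  -- This power is idempotent for `eqv c j`, and z and z x z are equivalent: z goes up to z x z by
  -- pumping, as x ∼_C y; z x z goes up to a power of y because y is above x at level j, and then to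
  -- z.
  set z := pw y (2 * N + 1) with hz
  have hzz : eqv c j (z ++ z) z := by
    rw [hz, ← pw_add]
    exact ⟨hpw _ (by omega) _ (by omega), hpw _ (by omega) _ (by omega)⟩
  have hzx : eqv c j z (z ++ x ++ z) := by
    refine ⟨hN _ (by omega) _ (by omega) _ (by omega) x hyx, ?_⟩
    have h1 : pre c j (z ++ x ++ z) (z ++ y ++ z) :=
      pre_append hc (pre_append hc (pre_refl _ _ _) hxy) (pre_refl _ _ _)
    refine pre_trans h1 ?_
    have h2 : z ++ y ++ z = pw y (2 * N + 1 + 1 + (2 * N + 1)) := by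
      rw [pw_add, pw_add, pw_one]
    rw [h2]
    exact hpw _ (by omega) _ (by omega)
  -- Pumping over `eqv c j` inserts z x z at the `fine` level. The word z^(K+1) has value e; its
  -- upset contains products realizing f ρ(x) f, through the inserted x, and f ρ(ε) f, without it.
  obtain ⟨K, hK1, hK⟩ := exists_pump (isCong_eqv hc j) hzz j
  have hfine : fine c j (pw z (K + 1)) (pw z K ++ (z ++ x ++ z) ++ pw z K) :=
    hK _ (by omega) _ le_rfl _ le_rfl _ hzx
  have hzf : HLe f (ρ (fineUp c j z)) := hle_fineUp_pw hR hc hf hyf (by omega)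
  have hKf : HLe f (ρ (fineUp c j (pw z K))) := hle_fineUp_pw hR hc hf hzf hK1
  refine ⟨pw z (K + 1), trivial, ?_, ?_⟩
  · exact val_pw α he (val_pw α he hye (by omega)) (by omega)
  · change HLe (f * (ρ {x} + ρ {[]}) * f) _
    rw [mul_add, add_mul]
    apply add_hle
    · have h1 : HLe (f * f * ρ {x} * (f * f))
          (ρ (fineUp c j (pw z K) * fineUp c j z * {x} * (fineUp c j z * fineUp c j (pw z K)))) := by
        simp only [map_mul]
        exact hle_mul hR (hle_mul hR (hle_mul hR hKf hzf) (hle_refl hR _)) (hle_mul hR hzf hKf)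
      rw [hf] at h1
      refine hle_trans h1 (map_hle_map ρ ?_)
      intro t ht
      obtain ⟨t₁, ht₁, t₂, ht₂, rfl⟩ := Language.mem_mul.1 ht
      obtain ⟨t₃, ht₃, x', hx', rfl⟩ := Language.mem_mul.1 ht₁
      rw [show x' = x from hx']
      have h3 := fineUp_mul_le hc _ _ _ ht₃
      have h4 := fineUp_mul_le hc _ _ _ ht₂
      have h5 : fine c j _ (t₃ ++ x ++ t₂) :=
        fine_append hc (fine_append hc h3 (fine_refl c j x)) h4
      refine fine_trans hfine ?_
      simpa using h5
    · have h1 := hle_mul hR (hle_mul hR hzf (hle_refl hR (ρ {[]}))) hKf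
      rw [map_mul_map_nil, ← map_mul] at h1
      rw [pw_succ]
      exact hle_trans h1 (map_hle_map ρ (fineUp_mul_le hc j _ _))

/-- The nested elements realized at all levels of the stratification. -/
def nestedTau (c : Setoid (List A)) (α : FreeMonoid A →* M) (ρ : Language A →ₙ+* R) :
    Set (R × Set (M × R)) :=
  {q | ∀ k, ∃ x, ρ {x} = q.1 ∧ q.2 ⊆ tau c α ρ (up c k x)}

theorem map_pw (ρ : Language A →ₙ+* R) {x : List A} {f : R} (hf : f * f = f) (hx : ρ {x} = f)
    {n : ℕ} (hn : 1 ≤ n) : ρ {pw x n} = f := by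
  induction n, hn using Nat.le_induction with
  | base => rw [pw_one, hx]
  | succ n _ ih => rw [pw_succ, map_append_singleton, hx, ih, hf]

theorem up_mul_le {c : Setoid (List A)} (hc : IsCong c) (k : ℕ) (x y : List A) :
    up c k x * up c k y ≤ up c k (x ++ y) := by
  intro z hz
  obtain ⟨x', hx, y', hy, rfl⟩ := Language.mem_mul.1 hz
  exact pre_append hc hx hy

theorem tau_restrictType_subset (hα : IsMorphismTypeMap C α tM) (hρ : IsRatingTypeMap C ρ tR)
    {x : List A} : restrictType tM (tau (canonicalSetoid C) α ρ ⊤) (tR (ρ {x})) ⊆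
      tau (canonicalSetoid C) α ρ (up (canonicalSetoid C) 0 x) := by
  rintro p ⟨hp, hpt⟩ j
  obtain ⟨y, -, hy, hyr⟩ := hp j
  refine ⟨y, ?_, hy, hyr⟩
  change canonicalSetoid C x y
  apply Quotient.exact
  exact ((hρ _ x rfl).trans hpt).trans (hα _ y hy).symm

/-- Soundness: the optimal pointed imprint is the first component of a saturated pair. -/
theorem isSaturatedPair_tau (hR : ∀ r : R, r + r = r) (hc : IsCong (canonicalSetoid C))
    (hα : IsMorphismTypeMap C α tM) (hρ : IsRatingTypeMap C ρ tR) :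
    IsSaturatedPair α tM ρ tR (tau (canonicalSetoid C) α ρ ⊤)
      (nestedTau (canonicalSetoid C) α ρ) where
  trivial_subset := by
    rintro ⟨s, r⟩ ⟨x, rfl, hr⟩ j
    refine ⟨x, trivial, rfl, hle_trans hr (map_hle_map ρ ?_)⟩
    rintro y rfl
    exact fine_refl _ _ _
  downset s r r' h hr := tau_down h hr
  mul s₁ r₁ s₂ r₂ h₁ h₂ :=
    tau_mono le_top (dmul_tau_subset hR hc ⊤ ⊤ ⟨_, h₁, _, h₂, rfl, hle_refl hR _⟩)
  pbpol_closure r T e f hT hef he hf := by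
    refine mem_tau_of_nested hR hc hα he hf fun k => ?_
    obtain ⟨x, hx, hsub⟩ := hT k
    exact ⟨x, hx, hsub hef⟩
  nested_trivial_subset := by
    rintro _ ⟨x, rfl⟩ k
    refine ⟨x, rfl, ?_⟩
    rintro p ⟨hp, hr⟩ j
    refine ⟨x, pre_refl _ _ _, hp.symm, hle_trans hr (map_hle_map ρ ?_)⟩
    rintro y rfl
    exact fine_refl _ _ _
  nested_downset r T T' h hT k := by
    obtain ⟨x, hx, hsub⟩ := h k
    exact ⟨x, hx, hT.trans hsub⟩
  nested_mul r₁ T₁ r₂ T₂ h₁ h₂ k := by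
    obtain ⟨x, hx, hsub⟩ := h₁ k
    obtain ⟨y, hy, hsub'⟩ := h₂ k
    refine ⟨x ++ y, ?_, ?_⟩
    · rw [map_append_singleton, hx, hy]
    · exact (dmul_mono hsub hsub').trans
        ((dmul_tau_subset hR hc _ _).trans (tau_mono (up_mul_le hc k x y)))
  nested_closure f E h hf hE k := by
    obtain ⟨x, hx, hsub⟩ := h k
    change ρ {x} = f at hx
    change E ⊆ _ at hsub
    have hxx : canonicalSetoid C (x ++ x) x :=
      cong_of_map_eq hρ (by rw [map_append_singleton, hx, hf])
    -- The witness is no longer x but x^N: E·E = E keeps E inside the imprint over words above x^N,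
    -- and x^N is below x^N y x^N for all y ∼_C x. Words y ∼_C x realize the restricted part of the
    -- imprint.
    obtain ⟨N, hN1, hN⟩ := exists_pump hc hxx k
    have hEN : ∀ n ≥ 1, E ⊆ tau (canonicalSetoid C) α ρ (up (canonicalSetoid C) k (pw x n)) := by
      intro n hn
      induction n, hn using Nat.le_induction with
      | base => rwa [pw_one]
      | succ n _ ih =>
        rw [pw_succ, ← hE]
        exact (dmul_mono hsub ih).trans
          ((dmul_tau_subset hR hc _ _).trans (tau_mono (up_mul_le hc k _ _)))
    refine ⟨pw x N, map_pw ρ hf hx hN1, ?_⟩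
    have h1 := hEN N hN1
    have h2 := tau_restrictType_subset (α := α) (ρ := ρ) (x := x) hα hρ
    rw [hx] at h2
    refine (dmul_mono (dmul_mono h1 h2) h1).trans ?_
    refine (dmul_mono (dmul_tau_subset hR hc _ _) subset_rfl).trans ?_
    refine (dmul_tau_subset hR hc _ _).trans (tau_mono ?_)
    intro t ht
    obtain ⟨t₁, ht₁, t₂, ht₂, rfl⟩ := Language.mem_mul.1 ht
    obtain ⟨t₃, ht₃, y, hy, rfl⟩ := Language.mem_mul.1 ht₁
    refine pre_trans (hN N le_rfl N le_rfl N le_rfl y hy) ?_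
    exact pre_append hc (pre_append hc ht₃ (pre_refl _ _ _)) ht₂

end

/-! ### Completeness for nested elements -/

theorem dmul_assoc {M : Type v} {R : Type w} [Monoid M] [NonUnitalSemiring R]
    (hR : ∀ r : R, r + r = r) (T₁ T₂ T₃ : Set (M × R)) :
    dmul (dmul T₁ T₂) T₃ = dmul T₁ (dmul T₂ T₃) := by
  ext p
  constructor
  · rintro ⟨q, ⟨p₁, h₁, p₂, h₂, hq, hq'⟩, p₃, h₃, hp, hp'⟩
    refine ⟨p₁, h₁, (p₂.1 * p₃.1, p₂.2 * p₃.2), ⟨p₂, h₂, p₃, h₃, rfl, hle_refl hR _⟩, ?_, ?_⟩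
    · rw [hp, hq, mul_assoc]
    · refine hle_trans hp' ?_
      rw [← mul_assoc]
      exact hle_mul hR hq' (hle_refl hR _)
  · rintro ⟨p₁, h₁, q, ⟨p₂, h₂, p₃, h₃, hq, hq'⟩, hp, hp'⟩
    refine ⟨(p₁.1 * p₂.1, p₁.2 * p₂.2), ⟨p₁, h₁, p₂, h₂, rfl, hle_refl hR _⟩, p₃, h₃, ?_, ?_⟩
    · rw [hp, hq, mul_assoc]
    · refine hle_trans hp' ?_
      rw [mul_assoc]
      exact hle_mul hR (hle_refl hR _) hq'

/-- The semigroup of sets of pairs under `dmul`. -/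
abbrev dmulSemigroup {M : Type v} {R : Type w} [Monoid M] [NonUnitalSemiring R]
    (hR : ∀ r : R, r + r = r) : Semigroup (Set (M × R)) where
  mul := dmul
  mul_assoc := dmul_assoc hR

/-- Closure of a language under factors. -/
def IsFactorClosed {A : Type u} (F : Language A) : Prop := ∀ x y z, x ++ y ++ z ∈ F → y ∈ F

theorem up_anti {A : Type u} {c : Setoid (List A)} {i j : ℕ} (hij : i ≤ j) (x : List A) :
    up c j x ≤ up c i x := fun _ h => pre_of_le hij h

section

variable {A : Type u} {M : Type v} {R : Type w} [Monoid M] [NonUnitalSemiring R]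
  {C : Set (Language A)} {α : FreeMonoid A →* M} {tM : M → CType C} {ρ : Language A →ₙ+* R}
  {tR : R → CType C} {S : Set (M × R)} {𝒯 : Set (R × Set (M × R))}

/-- Splitting costs one level, and factor closure keeps both halves in F. -/
theorem tau_inf_up_append_subset [Finite M] [Finite R] {c : Setoid (List A)} (hc : IsCong c)
    {F : Language A} (hF : IsFactorClosed F) (k : ℕ) (x y : List A) :
    tau c α ρ (F ⊓ up c (k + 1) (x ++ y)) ⊆
      dmul (tau c α ρ (F ⊓ up c k x)) (tau c α ρ (F ⊓ up c k y)) := by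
  refine (tau_mono ?_).trans (tau_mul_subset hc _ _)
  rintro z ⟨hzF, hz⟩
  change z ∈ F at hzF
  obtain ⟨z₁, z₂, rfl, h₁, h₂⟩ := pre_split hc hz
  exact Language.append_mem_mul ⟨hF [] z₁ z₂ (by simpa using hzF), h₁⟩
    ⟨hF z₁ z₂ [] (by simpa using hzF), h₂⟩

theorem tau_inf_up_anti {c : Setoid (List A)} {F : Language A} {i j : ℕ} (hij : i ≤ j)
    (x : List A) : tau c α ρ (F ⊓ up c j x) ⊆ tau c α ρ (F ⊓ up c i x) :=
  tau_mono (inf_le_inf le_rfl (up_anti hij x))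

theorem tau_inf_up_zero_subset (hα : IsMorphismTypeMap C α tM) (hρ : IsRatingTypeMap C ρ tR)
    {F : Language A} (hFS : tau (canonicalSetoid C) α ρ F ⊆ S) (x : List A) :
    tau (canonicalSetoid C) α ρ (F ⊓ up (canonicalSetoid C) 0 x) ⊆
      restrictType tM S (tR (ρ {x})) := by
  intro p hp
  refine ⟨hFS (tau_mono inf_le_left hp), ?_⟩
  obtain ⟨y, ⟨-, hxy⟩, hy, -⟩ := hp 0
  rw [← hρ _ x rfl, ← hα p.1 y hy]
  exact Quotient.sound hxy

/-- The value of the word `x` at level `k` belongs to `𝒯`, relatively to all factor-closed languages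
on which the optimal imprint is contained in `S`. -/
def IsNestedLevel (C : Set (Language A)) (α : FreeMonoid A →* M) (ρ : Language A →ₙ+* R)
    (S : Set (M × R)) (𝒯 : Set (R × Set (M × R))) (k : ℕ) (x : List A) : Prop :=
  ∀ F : Language A, IsFactorClosed F → tau (canonicalSetoid C) α ρ F ⊆ S →
    (ρ {x}, tau (canonicalSetoid C) α ρ (F ⊓ up (canonicalSetoid C) k x)) ∈ 𝒯

theorem IsNestedLevel.of_le (hS : IsSaturatedPair α tM ρ tR S 𝒯) {i j : ℕ} (hij : i ≤ j)
    {x : List A} (h : IsNestedLevel C α ρ S 𝒯 i x) : IsNestedLevel C α ρ S 𝒯 j x :=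
  fun F hF hFS => hS.nested_downset _ _ _ (h F hF hFS) (tau_inf_up_anti hij x)

theorem IsNestedLevel.append [Finite M] [Finite R] (hS : IsSaturatedPair α tM ρ tR S 𝒯)
    (hc : IsCong (canonicalSetoid C)) {k : ℕ} {x y : List A} (hx : IsNestedLevel C α ρ S 𝒯 k x)
    (hy : IsNestedLevel C α ρ S 𝒯 k y) : IsNestedLevel C α ρ S 𝒯 (k + 1) (x ++ y) := by
  intro F hF hFS
  rw [map_append_singleton]
  exact hS.nested_downset _ _ _ (hS.nested_mul _ _ _ _ (hx F hF hFS) (hy F hF hFS))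
    (tau_inf_up_append_subset hc hF k x y)

/-- Operation (6) applied to the idempotent set E of trivial pairs of ε yields all pairs of S of the
type of ε, because ρ(ε) is neutral for images of languages. -/
theorem isNestedLevel_nil [Finite M] [Finite R] (hR : ∀ r : R, r + r = r)
    (hS : IsSaturatedPair α tM ρ tR S 𝒯) (hα : IsMorphismTypeMap C α tM)
    (hρ : IsRatingTypeMap C ρ tR) : IsNestedLevel C α ρ S 𝒯 0 [] := by
  intro F _ hFS
  let E : Set (M × R) := {p | p.1 = val α [] ∧ HLe p.2 (ρ {[]})}
  have hE : (ρ {[]}, E) ∈ 𝒯 := hS.nested_trivial_subset ⟨[], rfl⟩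
  have hρ1 : ρ {[]} * ρ {[]} = ρ {[]} := map_mul_map_nil ρ _
  have hEmem : ((1 : M), ρ {[]}) ∈ E := ⟨(val_nil α).symm, hle_refl hR _⟩
  have hEE : dmul E E = E := by
    ext p
    constructor
    · rintro ⟨p₁, h₁, p₂, h₂, hp, hp'⟩
      refine ⟨?_, ?_⟩
      · rw [hp, h₁.1, h₂.1, val_nil, one_mul]
      · have := hle_mul hR h₁.2 h₂.2
        rw [hρ1] at this
        exact hle_trans hp' this
    · rintro ⟨hp, hp'⟩
      refine ⟨_, hEmem, _, hEmem, ?_, ?_⟩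
      · rw [hp, val_nil, one_mul]
      · rwa [hρ1]
  refine hS.nested_downset _ _ _ (hS.nested_closure _ _ hE hρ1 hEE) ?_
  obtain ⟨j, hj⟩ := exists_tau_level (canonicalSetoid C) α ρ (F ⊓ up (canonicalSetoid C) 0 [])
  intro p hp
  obtain ⟨x, hx, hxs, hxr⟩ := hp j
  have hmem := tau_inf_up_zero_subset hα hρ hFS [] (hj j le_rfl x hx)
  refine ⟨(1 * val α x, ρ {[]} * ρ (fineUp (canonicalSetoid C) j x)),
    ⟨_, hEmem, _, hmem, rfl, hle_refl hR _⟩, _, hEmem, ?_, ?_⟩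
  · rw [one_mul, mul_one, hxs]
  · rwa [map_nil_mul_map, map_mul_map_nil]

/-- A word above [a] at level 1 is a word of the type of ε, then a, then another word of that type;
so the case of ε is used on both sides. -/
theorem isNestedLevel_letter [Finite M] [Finite R] (hR : ∀ r : R, r + r = r)
    (hS : IsSaturatedPair α tM ρ tR S 𝒯) (hc : IsCong (canonicalSetoid C))
    (hα : IsMorphismTypeMap C α tM) (hρ : IsRatingTypeMap C ρ tR) (a : A) :
    IsNestedLevel C α ρ S 𝒯 1 [a] := by
  intro F hF hFS
  have h0 := isNestedLevel_nil hR hS hα hρ F hF hFS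
  have ha : (ρ {[a]}, {p : M × R | p.1 = val α [a] ∧ HLe p.2 (ρ {[a]})}) ∈ 𝒯 :=
    hS.nested_trivial_subset ⟨[a], rfl⟩
  have h1 := hS.nested_mul _ _ _ _ (hS.nested_mul _ _ _ _ h0 ha) h0
  rw [map_nil_mul_map, map_mul_map_nil] at h1
  refine hS.nested_downset _ _ _ h1 ?_
  have hle : F ⊓ up (canonicalSetoid C) 1 [a] ≤
      (F ⊓ up (canonicalSetoid C) 0 []) * {[a]} * (F ⊓ up (canonicalSetoid C) 0 []) := by
    rintro z ⟨hzF, hz⟩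
    change z ∈ F at hzF
    obtain ⟨y₁, y₂, rfl, h₁, h₂⟩ := hz.2 [] a [] rfl
    exact mem_marked.2 ⟨y₁, ⟨hF [] y₁ (a :: y₂) (by simpa using hzF), h₁⟩, y₂,
      ⟨hF (y₁ ++ [a]) y₂ [] (by simpa using hzF), h₂⟩, rfl⟩
  refine (tau_mono hle).trans ((tau_mul_subset hc _ _).trans (dmul_mono ?_ subset_rfl))
  refine (tau_mul_subset hc _ _).trans (dmul_mono subset_rfl ?_)
  intro p hp
  obtain ⟨x, hx, hxs, hxr⟩ := hp 2
  have hx : x = [a] := hx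
  subst hx
  refine ⟨hxs.symm, hle_trans hxr (map_hle_map ρ ?_)⟩
  intro y hy
  exact eq_letter_of_fine le_rfl hy

theorem map_flatten_eq {L : Language A} {f : R} (hL : ∀ x ∈ L, ρ {x} = f) (hf : f * f = f)
    {l : List (List A)} (hl : ∀ x ∈ l, x ∈ L) (h0 : l ≠ []) : ρ {l.flatten} = f := by
  induction l with
  | nil => exact (h0 rfl).elim
  | cons x l ih =>
    have hx := hL x (hl x List.mem_cons_self)
    by_cases h : l = []
    · subst h
      simpa using hx
    · rw [List.flatten_cons, map_append_singleton, hx,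
        ih (fun y hy => hl y (List.mem_cons_of_mem _ hy)) h, hf]

/-- Evaluate each factor by its imprint in the finite semigroup of sets under `dmul`. A bracketed
list has outer blocks of idempotent value E = g with (f, E) in 𝒯; its middle has the type of f, so
its imprint at level 0 lies in the restriction of S. Operation (6) gives E·T·E. -/
theorem exists_isNestedLevel_kstar [Finite M] [Finite R] (hR : ∀ r : R, r + r = r)
    (hS : IsSaturatedPair α tM ρ tR S 𝒯) (hc : IsCong (canonicalSetoid C))
    (hα : IsMorphismTypeMap C α tM) (hρ : IsRatingTypeMap C ρ tR) {L : Language A} {f : R}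
    (hf : f * f = f) (hLf : ∀ x ∈ L, ρ {x} = f) {k₀ : ℕ}
    (hL : ∀ x ∈ L, IsNestedLevel C α ρ S 𝒯 k₀ x) :
    ∃ k, ∀ x ∈ L∗, IsNestedLevel C α ρ S 𝒯 k x := by
  let : Semigroup (Set (M × R)) := dmulSemigroup hR
  set c := canonicalSetoid C with hcdef
  let φ : Language A → List A → Set (M × R) := fun F x => tau c α ρ (F ⊓ up c k₀ x)
  have hval : ∀ F, IsFactorClosed F → tau c α ρ F ⊆ S → ∀ l : List (List A), (∀ x ∈ l, x ∈ L) →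
      ∀ g : Set (M × R), sprod (l.map (φ F)) = g →
      (ρ {l.flatten}, g) ∈ 𝒯 ∧ tau c α ρ (F ⊓ up c (k₀ + l.length) l.flatten) ⊆ g := by
    intro F hF hFS l
    induction l with
    | nil =>
      intro _ g hg
      exact (ne_nil_of_sprod_eq_coe hg rfl).elim
    | cons x l ih =>
      intro hl g hg
      have hx := hL x (hl x List.mem_cons_self) F hF hFS
      by_cases h : l = []
      · subst h
        have hg : φ F x = g := by simpa using hg
        subst hg
        simp only [List.flatten_cons, List.flatten_nil, List.append_nil]
        exact ⟨hx, tau_inf_up_anti (by omega) x⟩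
      · obtain ⟨g', hg'⟩ := exists_sprod_eq_coe (l := l.map (φ F)) (by simpa using h)
        rw [List.map_cons, sprod_cons, hg', ← WithOne.coe_mul] at hg
        obtain ⟨h1, h2⟩ := ih (fun y hy => hl y (List.mem_cons_of_mem _ hy)) g' hg'
        rw [← WithOne.coe_inj.1 hg]
        rw [List.flatten_cons, map_append_singleton]
        refine ⟨hS.nested_mul _ _ _ _ hx h1, ?_⟩
        rw [List.length_cons, ← add_assoc]
        exact (tau_inf_up_append_subset hc hF _ x _).trans
          (dmul_mono (tau_inf_up_anti (by omega) x) h2)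
  let G : Language (Set (M × R)) → Prop := fun Λ => ∃ k, ∀ F, IsFactorClosed F →
    tau c α ρ F ⊆ S → ∀ l : List (List A), (∀ x ∈ l, x ∈ L) → l.map (φ F) ∈ Λ →
      (ρ {l.flatten}, tau c α ρ (F ⊓ up c k l.flatten)) ∈ 𝒯
  have hG : IsRatClosed G := by
    refine ⟨?_, ⟨0, ?_⟩, fun v => ⟨k₀, ?_⟩, ?_, ?_⟩
    · rintro K Λ hK ⟨k, hk⟩
      exact ⟨k, fun F hF hFS l hl hlK => hk F hF hFS l hl (hK hlK)⟩
    · intro F hF hFS l hl hlΛ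
      have : l = [] := List.map_eq_nil_iff.1 hlΛ
      subst this
      exact isNestedLevel_nil hR hS hα hρ F hF hFS
    · intro F hF hFS l hl hlΛ
      obtain ⟨x, rfl, -⟩ := List.map_eq_singleton_iff.1 (show l.map (φ F) = [v] from hlΛ)
      have := hL x (hl x List.mem_cons_self) F hF hFS
      simpa using this
    · rintro K Λ ⟨k, hk⟩ ⟨k', hk'⟩
      refine ⟨max k k', ?_⟩
      rintro F hF hFS l hl (h | h)
      · exact hS.nested_downset _ _ _ (hk F hF hFS l hl h) (tau_inf_up_anti (le_max_left _ _) _)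
      · exact hS.nested_downset _ _ _ (hk' F hF hFS l hl h) (tau_inf_up_anti (le_max_right _ _) _)
    · rintro K Λ ⟨k, hk⟩ ⟨k', hk'⟩
      refine ⟨max k k' + 1, ?_⟩
      intro F hF hFS l hl h
      obtain ⟨u, hu, v, hv, huv⟩ := Language.mem_mul.1 h
      obtain ⟨l₁, l₂, rfl, rfl, rfl⟩ := List.map_eq_append_iff.1 huv.symm
      have h1 := hk F hF hFS l₁ (fun x hx => hl x (by simp [hx])) hu
      have h2 := hk' F hF hFS l₂ (fun x hx => hl x (by simp [hx])) hv
      rw [List.flatten_append, map_append_singleton]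
      exact hS.nested_downset _ _ _ (hS.nested_mul _ _ _ _ h1 h2)
        ((tau_inf_up_append_subset hc hF _ _ _).trans
          (dmul_mono (tau_inf_up_anti (le_max_left _ _) _) (tau_inf_up_anti (le_max_right _ _) _)))
  have htop : G ⊤ := by
    refine ratClosed_top_of_bracket hG ?_
    intro g l l' hg hl hl'
    obtain ⟨k₁, hk₁⟩ := hG.singleton (l ++ l')
    -- Levels paid for splitting the two outer blocks into factors; the extra 2 separates the three
    -- parts.
    let k₂ := k₀ + l.length + l'.length
    refine ⟨max k₁ (k₂ + 2), ?_⟩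
    rintro F hF hFS t ht ⟨m, hm⟩
    obtain ⟨t', ty, rfl, ht', hty⟩ := List.map_eq_append_iff.1 hm
    obtain ⟨tx, tm, rfl, htx, htm⟩ := List.map_eq_append_iff.1 ht'
    -- An empty middle need not have the type of f. The list of values is then the fixed list l ++
    -- l', handled separately.
    by_cases hm0 : tm = []
    · subst hm0
      refine hS.nested_downset _ _ _ (hk₁ F hF hFS _ ht ?_)
        (tau_inf_up_anti (le_max_left _ _) _)
      change List.map _ _ = _
      simp [htx, hty]
    · have hLx : ∀ x ∈ tx, x ∈ L := fun x hx => ht x (by simp [hx])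
      have hLm : ∀ x ∈ tm, x ∈ L := fun x hx => ht x (by simp [hx])
      have hLy : ∀ x ∈ ty, x ∈ L := fun x hx => ht x (by simp [hx])
      obtain ⟨hx1, hx2⟩ := hval F hF hFS tx hLx g (by rw [htx, hl])
      obtain ⟨hy1, hy2⟩ := hval F hF hFS ty hLy g (by rw [hty, hl'])
      have hx0 : tx ≠ [] := by
        rintro rfl
        exact ne_nil_of_sprod_eq_coe hl htx.symm
      rw [map_flatten_eq hLf hf hLx hx0] at hx1
      rw [map_flatten_eq hLf hf ht (by simp [hx0])]
      refine hS.nested_downset _ _ _ (hS.nested_closure f g hx1 hf hg) ?_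
      have hxlen : tx.length = l.length := by rw [← htx, List.length_map]
      have hylen : ty.length = l'.length := by rw [← hty, List.length_map]
      have hmid := tau_inf_up_zero_subset hα hρ hFS tm.flatten
      rw [map_flatten_eq hLf hf hLm hm0] at hmid
      refine (tau_inf_up_anti (le_max_right _ _) _).trans ?_
      rw [List.flatten_append, List.flatten_append]
      refine (tau_inf_up_append_subset hc hF _ _ _).trans (dmul_mono ?_ ?_)
      · refine (tau_inf_up_append_subset hc hF _ _ _).trans (dmul_mono ?_ ?_)
        · exact (tau_inf_up_anti (by omega) _).trans hx2
        · exact (tau_inf_up_anti (by omega) _).trans hmid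
      · exact (tau_inf_up_anti (by omega) _).trans hy2
  obtain ⟨k, hk⟩ := htop
  refine ⟨k, ?_⟩
  intro x hx F hF hFS
  obtain ⟨l, rfl, hl⟩ := Language.mem_kstar.1 hx
  exact hk F hF hFS l hl trivial

/-- Completeness for nested elements, uniformly in the factor-closed language. -/
theorem exists_isNestedLevel [Finite A] [Finite M] [Finite R] (hR : ∀ r : R, r + r = r)
    (hS : IsSaturatedPair α tM ρ tR S 𝒯) (hc : IsCong (canonicalSetoid C))
    (hα : IsMorphismTypeMap C α tM) (hρ : IsRatingTypeMap C ρ tR) :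
    ∃ k, ∀ x, IsNestedLevel C α ρ S 𝒯 k x := by
  let d : Setoid (List A) := Setoid.ker fun x => ρ {x}
  have hd : IsCong d := by
    intro x x' y y' hx hy
    change ρ _ = ρ _
    rw [map_append_singleton, map_append_singleton, show ρ {x} = ρ {x'} from hx,
      show ρ {y} = ρ {y'} from hy]
  have : Finite (Quotient d) := Finite.of_injective _ (Setoid.kerLift_injective _)
  let G : Language A → Prop := fun L => ∃ k, ∀ x ∈ L, IsNestedLevel C α ρ S 𝒯 k x
  have hG : IsRatClosed G := by
    refine ⟨?_, ⟨0, ?_⟩, fun a => ⟨1, ?_⟩, ?_, ?_⟩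
    · rintro K L hKL ⟨k, hk⟩
      exact ⟨k, fun x hx => hk x (hKL hx)⟩
    · rintro x rfl
      exact isNestedLevel_nil hR hS hα hρ
    · rintro x rfl
      exact isNestedLevel_letter hR hS hc hα hρ a
    · rintro K L ⟨k, hk⟩ ⟨k', hk'⟩
      refine ⟨max k k', ?_⟩
      rintro x (hx | hx)
      · exact (hk x hx).of_le hS (le_max_left _ _)
      · exact (hk' x hx).of_le hS (le_max_right _ _)
    · rintro K L ⟨k, hk⟩ ⟨k', hk'⟩
      refine ⟨max k k' + 1, ?_⟩
      intro z hz
      obtain ⟨x, hx, y, hy, rfl⟩ := Language.mem_mul.1 hz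
      exact ((hk x hx).of_le hS (le_max_left _ _)).append hS hc
        ((hk' y hy).of_le hS (le_max_right _ _))
  obtain ⟨k, hk⟩ : G ⊤ := by
    refine ratClosed_top hd hG ?_
    rintro L ⟨k, hk⟩ h1 h2
    by_cases hne : ∃ x, x ∈ L
    · obtain ⟨x₀, hx₀⟩ := hne
      refine exists_isNestedLevel_kstar hR hS hc hα hρ (f := ρ {x₀}) ?_
        (fun x hx => h1 x hx x₀ hx₀) hk
      rw [← map_append_singleton]
      exact h2 x₀ hx₀
    · refine hG.mono ?_ hG.one
      intro x hx
      refine kstar_induction (p := fun x => x ∈ (1 : Language A)) rfl ?_ hx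
      intro y hy
      exact (hne ⟨y, hy⟩).elim
  exact ⟨k, fun x => hk x trivial⟩

end

/-! ### Completeness for the pointed imprint -/

/-- The language of all factors of words of `L`. -/
def factors {A : Type u} (L : Language A) : Language A := {y | ∃ x z, x ++ y ++ z ∈ L}

theorem isFactorClosed_factors {A : Type u} (L : Language A) : IsFactorClosed (factors L) := by
  rintro x y z ⟨x', z', h⟩
  exact ⟨x' ++ x, z ++ z', by simpa using h⟩

theorem le_factors {A : Type u} (L : Language A) : L ≤ factors L :=
  fun x hx => ⟨[], [], by rw [List.nil_append, List.append_nil]; exact hx⟩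

theorem factors_mul_le {A : Type u} (K L : Language A) :
    factors (K * L) ≤ factors K * factors L := by
  rintro y ⟨x, z, h⟩
  obtain ⟨p, hp, q, hq, hpq⟩ := Language.mem_mul.1 h
  rw [List.append_assoc] at hpq
  rcases List.append_eq_append_iff.1 hpq with ⟨t, rfl, rfl⟩ | ⟨t, rfl, ht⟩
  · have := Language.append_mem_mul (l := factors K) (m := factors L) (a := []) (b := y)
      ⟨p, [], by simpa using hp⟩ ⟨t, z, by simpa using hq⟩
    exact this
  · rcases List.append_eq_append_iff.1 ht with ⟨t', rfl, rfl⟩ | ⟨t', rfl, rfl⟩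
    · have := Language.append_mem_mul (l := factors K) (m := factors L) (a := y) (b := [])
        ⟨x, t', by simpa using hp⟩ ⟨[], q, by simpa using hq⟩
      rw [List.append_nil] at this
      exact this
    · exact Language.append_mem_mul ⟨x, [], by simpa using hp⟩ ⟨[], z, by simpa using hq⟩

theorem prefix_mem_of_flatten {A : Type u} {L : Language A} {l : List (List A)}
    (hl : ∀ x ∈ l, x ∈ L) {y z : List A} (h : y ++ z = l.flatten) :
    y ∈ L∗ * (1 + factors L) := by
  induction l generalizing y with
  | nil =>
    rw [List.flatten_nil, List.append_eq_nil_iff] at h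
    rw [h.1]
    exact Language.append_mem_mul (a := []) (Language.nil_mem_kstar _) (Or.inl rfl)
  | cons x l ih =>
    have hx := hl x List.mem_cons_self
    rw [List.flatten_cons] at h
    rcases List.append_eq_append_iff.1 h with ⟨t, rfl, ht⟩ | ⟨t, rfl, ht⟩
    · exact Language.append_mem_mul (a := []) (Language.nil_mem_kstar _)
        (Or.inr ⟨[], t, by simpa using hx⟩)
    · obtain ⟨p, hp, q, hq, rfl⟩ :=
        Language.mem_mul.1 (ih (fun y hy => hl y (List.mem_cons_of_mem _ hy)) ht.symm)
      rw [← List.append_assoc]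
      exact Language.append_mem_mul ((mul_kstar_le_kstar : L * L∗ ≤ L∗)
        (Language.append_mem_mul hx hp)) hq

theorem factors_kstar_le {A : Type u} (L : Language A) :
    factors (L∗) ≤ (1 + factors L) * (L∗ * (1 + factors L)) := by
  rintro y ⟨x, z, h⟩
  obtain ⟨l, hxyz, hl⟩ := Language.mem_kstar.1 h
  clear h
  induction l generalizing x with
  | nil =>
    have : y = [] := by
      rw [List.flatten_nil, List.append_eq_nil_iff, List.append_eq_nil_iff] at hxyz
      exact hxyz.1.2
    rw [this]
    exact Language.append_mem_mul (a := []) (Or.inl rfl)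
      (Language.append_mem_mul (a := []) (Language.nil_mem_kstar _) (Or.inl rfl))
  | cons w l ih =>
    have hw := hl w List.mem_cons_self
    have hl' : ∀ x ∈ l, x ∈ L := fun y hy => hl y (List.mem_cons_of_mem _ hy)
    rw [List.flatten_cons, List.append_assoc] at hxyz
    rcases List.append_eq_append_iff.1 hxyz with ⟨t, rfl, ht⟩ | ⟨t, rfl, ht⟩
    · rcases List.append_eq_append_iff.1 ht with ⟨t', rfl, ht'⟩ | ⟨t', rfl, ht'⟩
      · have := Language.append_mem_mul (l := 1 + factors L) (m := L∗ * (1 + factors L)) (a := y)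
          (b := [] ++ []) (Or.inr ⟨x, t', by simpa using hw⟩)
          (Language.append_mem_mul (Language.nil_mem_kstar _) (Or.inl rfl))
        rw [List.append_nil, List.append_nil] at this
        exact this
      · exact Language.append_mem_mul (Or.inr ⟨x, [], by simpa using hw⟩)
          (prefix_mem_of_flatten hl' ht'.symm)
    · exact ih t (by rw [List.append_assoc]; exact ht.symm) hl'

section

variable {A : Type u} {M : Type v} {R : Type w} [Monoid M] [NonUnitalSemiring R]
  {C : Set (Language A)} {α : FreeMonoid A →* M} {tM : M → CType C} {ρ : Language A →ₙ+* R}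
  {tR : R → CType C} {S : Set (M × R)} {𝒯 : Set (R × Set (M × R))}

/-- The value of the word `x` at level `j` belongs to `S`. -/
def IsLevel (C : Set (Language A)) (α : FreeMonoid A →* M) (ρ : Language A →ₙ+* R)
    (S : Set (M × R)) (j : ℕ) (x : List A) : Prop :=
  (val α x, ρ (fineUp (canonicalSetoid C) j x)) ∈ S

theorem IsLevel.of_le (hS : IsSaturatedPair α tM ρ tR S 𝒯) {i j : ℕ} (hij : i ≤ j) {x : List A}
    (h : IsLevel C α ρ S i x) : IsLevel C α ρ S j x :=
  hS.downset _ _ _ h (map_hle_map ρ (fineUp_anti hij x))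

theorem IsLevel.append (hS : IsSaturatedPair α tM ρ tR S 𝒯) (hc : IsCong (canonicalSetoid C))
    {j : ℕ} {x y : List A} (hx : IsLevel C α ρ S j x) (hy : IsLevel C α ρ S j y) :
    IsLevel C α ρ S (j + 1) (x ++ y) := by
  have h := hS.mul _ _ _ _ hx hy
  rw [← map_mul, ← val_append] at h
  exact hS.downset _ _ _ h (map_hle_map ρ (fineUp_append_le hc j x y))

theorem isLevel_nil (hS : IsSaturatedPair α tM ρ tR S 𝒯) : IsLevel C α ρ S 1 [] :=
  hS.trivial_subset ⟨[], rfl, map_hle_map ρ fun _ hy => eq_nil_of_fine le_rfl hy⟩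

theorem isLevel_letter (hS : IsSaturatedPair α tM ρ tR S 𝒯) (a : A) : IsLevel C α ρ S 2 [a] :=
  hS.trivial_subset ⟨[a], rfl, map_hle_map ρ fun _ hy => eq_letter_of_fine le_rfl hy⟩

theorem tau_subset_of_isLevel (hS : IsSaturatedPair α tM ρ tR S 𝒯) {X : Language A} {j : ℕ}
    (h : ∀ x ∈ X, IsLevel C α ρ S j x) : tau (canonicalSetoid C) α ρ X ⊆ S := by
  rintro ⟨s, r⟩ hp
  obtain ⟨x, hx, rfl, hr⟩ := hp j
  exact hS.downset _ _ _ (h x hx) hr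

/-- The bound is required on all factors, not only on the words of L: this provides factor-closed
languages with imprint in S, as nested completeness demands. -/
theorem isRatClosed_isLevel (hS : IsSaturatedPair α tM ρ tR S 𝒯)
    (hc : IsCong (canonicalSetoid C)) :
    IsRatClosed fun L => ∃ j, ∀ x ∈ factors L, IsLevel C α ρ S j x := by
  refine ⟨?_, ⟨1, ?_⟩, fun a => ⟨2, ?_⟩, ?_, ?_⟩
  · rintro K L hKL ⟨j, hj⟩
    refine ⟨j, ?_⟩
    rintro y ⟨x, z, h⟩
    exact hj y ⟨x, z, hKL h⟩
  · rintro y ⟨x, z, h⟩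
    have h : x ++ y ++ z = [] := h
    simp only [List.append_eq_nil_iff] at h
    rw [h.1.2]
    exact isLevel_nil hS
  · rintro y ⟨x, z, h⟩
    have h : x ++ y ++ z = [a] := h
    rcases y with _ | ⟨b, y⟩
    · exact (isLevel_nil hS).of_le hS (by omega)
    · have hlen := congrArg List.length h
      simp only [List.length_append, List.length_cons, List.length_nil] at hlen
      have hx : x = [] := List.length_eq_zero_iff.1 (by omega)
      have hy : y = [] := List.length_eq_zero_iff.1 (by omega)
      have hz : z = [] := List.length_eq_zero_iff.1 (by omega)
      subst hx hy hz
      have hb : b = a := by simpa using h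
      rw [hb]
      exact isLevel_letter hS a
  · rintro K L ⟨j, hj⟩ ⟨j', hj'⟩
    refine ⟨max j j', ?_⟩
    rintro y ⟨x, z, h | h⟩
    · exact (hj y ⟨x, z, h⟩).of_le hS (le_max_left _ _)
    · exact (hj' y ⟨x, z, h⟩).of_le hS (le_max_right _ _)
  · rintro K L ⟨j, hj⟩ ⟨j', hj'⟩
    refine ⟨max j j' + 1, ?_⟩
    intro y hy
    obtain ⟨y₁, h₁, y₂, h₂, rfl⟩ := Language.mem_mul.1 (factors_mul_le K L hy)
    exact ((hj y₁ h₁).of_le hS (le_max_left _ _)).append hS hc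
      ((hj' y₂ h₂).of_le hS (le_max_right _ _))

/-- The summand ρ(ε) turns products into sums: multiplying the terms g (r + ρ(ε)) g and expanding,
each g r g appears alone, as does g. Closure under the order keeps only these summands. -/
theorem mem_of_sum (hR : ∀ r : R, r + r = r) (hS : IsSaturatedPair α tM ρ tR S 𝒯) {e : M} {g : R}
    (he : e * e = e) (hg : g * g = g) (hgρ : g * ρ {[]} = g) (heg : (e, g) ∈ S) (l : List R)
    (hl : ∀ r ∈ l, (e, g * (r + ρ {[]}) * g) ∈ S) : (e, g * l.sum * g + g) ∈ S := by
  induction l with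
  | nil => simpa using heg
  | cons r l ih =>
    have h1 := ih fun r hr => hl r (List.mem_cons_of_mem _ hr)
    have h2 := hS.mul _ _ _ _ h1 (hl r List.mem_cons_self)
    rw [he] at h2
    refine hS.downset _ _ _ h2 ?_
    have hexp : (g * l.sum * g + g) * (g * (r + ρ {[]}) * g) =
        (g * l.sum * g * (g * r * g) + g * l.sum * g) + (g * r * g + g) := by
      have h3 : g * (r + ρ {[]}) * g = g * r * g + g := by
        rw [mul_add, add_mul, hgρ, hg]
      have h4 : g * l.sum * g * g = g * l.sum * g := by rw [mul_assoc, hg]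
      have h5 : g * (g * r * g) = g * r * g := by rw [← mul_assoc, ← mul_assoc, hg]
      rw [h3, add_mul, mul_add, mul_add, h4, h5, hg]
    rw [hexp, List.sum_cons, mul_add, add_mul]
    refine add_hle (add_hle ?_ ?_) ?_
    · exact hle_trans (hle_add_left hR _ _) (hle_add_right hR _ _)
    · exact hle_trans (hle_add_right hR _ _) (hle_add_left hR _ _)
    · exact hle_trans (hle_add_right hR _ _) (hle_add_right hR _ _)

theorem cong_flatten {d : Setoid (List A)} (hd : IsCong d) {L : Language A} {x₀ : List A}
    (h1 : ∀ x ∈ L, d x x₀) (h2 : d (x₀ ++ x₀) x₀) {l : List (List A)} (hl : ∀ x ∈ l, x ∈ L)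
    (h0 : l ≠ []) : d l.flatten x₀ := by
  induction l with
  | nil => exact (h0 rfl).elim
  | cons x l ih =>
    have hx := h1 x (hl x List.mem_cons_self)
    by_cases h : l = []
    · subst h
      simpa using hx
    · rw [List.flatten_cons]
      exact d.trans (hd _ _ _ _ hx (ih (fun y hy => hl y (List.mem_cons_of_mem _ hy)) h)) h2

/-- The congruence that combines the value of a word with its type at level `k`. -/
def valEqv (c : Setoid (List A)) (α : FreeMonoid A →* M) (k : ℕ) : Setoid (List A) where
  r x y := val α x = val α y ∧ eqv c k x y
  iseqv := ⟨fun x => ⟨rfl, (eqv c k).refl x⟩, fun h => ⟨h.1.symm, (eqv c k).symm h.2⟩,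
    fun h h' => ⟨h.1.trans h'.1, (eqv c k).trans h.2 h'.2⟩⟩

theorem isCong_valEqv {c : Setoid (List A)} (hc : IsCong c) (k : ℕ) : IsCong (valEqv c α k) := by
  intro x x' y y' hx hy
  refine ⟨?_, isCong_eqv hc k _ _ _ _ hx.2 hy.2⟩
  rw [val_append, val_append, hx.1, hy.1]

theorem finite_quotient_valEqv [Finite A] [Finite M] (c : Setoid (List A)) [Finite (Quotient c)]
    (k : ℕ) : Finite (Quotient (valEqv c α k)) := by
  have := finite_quotient_eqv c k
  refine Finite.of_injective (β := M × Quotient (eqv c k))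
    (Quotient.lift (s := valEqv c α k) (fun x => (val α x, Quotient.mk (eqv c k) x)) ?_) ?_
  · intro x y h
    exact Prod.ext h.1 (Quotient.sound h.2)
  · intro p q
    induction p using Quotient.inductionOn with | _ x
    induction q using Quotient.inductionOn with | _ y
    intro h
    have h := Prod.ext_iff.1 h
    exact Quotient.sound ⟨h.1, Quotient.exact h.2⟩

/-- Evaluate each factor by the image of its upset, in the multiplicative semigroup of R. For a list
bracketed by blocks of idempotent value g, operation (3) inserts between two copies of g the image
of any word equivalent to the middle at level k; niceness sums these into the image of the whole
class, which contains the upset of the middle. -/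
theorem exists_isLevel_kstar [Finite M] [Finite R] (hR : ∀ r : R, r + r = r)
    (hS : IsSaturatedPair α tM ρ tR S 𝒯) (hc : IsCong (canonicalSetoid C)) (hnice : IsNice ρ)
    {k : ℕ} (hk : ∀ x, IsNestedLevel C α ρ S 𝒯 k x) {L : Language A} {x₀ : List A}
    (hL1 : ∀ x ∈ L, valEqv (canonicalSetoid C) α k x x₀)
    (hL2 : valEqv (canonicalSetoid C) α k (x₀ ++ x₀) x₀)
    (hL : ∃ j, ∀ x ∈ factors L, IsLevel C α ρ S j x) :
    ∃ j, ∀ x ∈ L∗, IsLevel C α ρ S j x := by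
  set c := canonicalSetoid C with hcdef
  set e := val α x₀ with he
  have hee : e * e = e := by rw [he, ← val_append, hL2.1]
  have hflat : ∀ l : List (List A), (∀ x ∈ l, x ∈ L) → l ≠ [] → valEqv c α k l.flatten x₀ :=
    fun l hl h0 => cong_flatten (isCong_valEqv hc k) hL1 hL2 hl h0
  have hpow : ∀ n, ∃ j, ∀ x ∈ factors (L ^ n), IsLevel C α ρ S j x := by
    intro n
    have hG := isRatClosed_isLevel (C := C) hS hc
    induction n with
    | zero => exact hG.one
    | succ n ih => exact hG.mul ih hL
  obtain ⟨j₀, hj₀⟩ := hL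
  obtain ⟨j₁, hj₁⟩ := exists_tau_level c α ρ L
  let j := max (max j₀ j₁) k
  have hj₀' : j₀ ≤ j := le_trans (le_max_left _ _) (le_max_left _ _)
  have hj₁' : j₁ ≤ j := le_trans (le_max_right _ _) (le_max_left _ _)
  have hkj : k ≤ j := le_max_right _ _
  let φ : List A → R := fun x => ρ (fineUp c j x)
  have hval : ∀ l : List (List A), (∀ x ∈ l, x ∈ L) → ∀ g : R, sprod (l.map φ) = g →
      (∃ K, g = ρ K) ∧ HLe (ρ (fineUp c (j + l.length) l.flatten)) g ∧
        (val α l.flatten, g) ∈ tau c α ρ (L ^ l.length) := by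
    intro l
    induction l with
    | nil =>
      intro _ g hg
      exact (ne_nil_of_sprod_eq_coe hg rfl).elim
    | cons x l ih =>
      intro hl g hg
      have hx := hl x List.mem_cons_self
      by_cases h : l = []
      · subst h
        have hg : φ x = g := by simpa using hg
        subst hg
        simp only [List.flatten_cons, List.flatten_nil, List.append_nil, List.length_cons,
          List.length_nil, zero_add, pow_one]
        exact ⟨⟨_, rfl⟩, map_hle_map ρ (fineUp_anti (by omega) x), hj₁ j hj₁' x hx⟩
      · obtain ⟨g', hg'⟩ := exists_sprod_eq_coe (l := l.map φ) (by simpa using h)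
        rw [List.map_cons, sprod_cons, hg', ← WithOne.coe_mul] at hg
        obtain ⟨⟨K, hK⟩, h2, h3⟩ := ih (fun y hy => hl y (List.mem_cons_of_mem _ hy)) g' hg'
        rw [← WithOne.coe_inj.1 hg]
        rw [List.flatten_cons, List.length_cons, ← add_assoc]
        refine ⟨⟨fineUp c j x * K, by rw [map_mul, hK]⟩, ?_, ?_⟩
        · refine hle_trans (map_hle_map ρ (fineUp_append_le hc _ x _)) ?_
          rw [map_mul]
          exact hle_mul hR (map_hle_map ρ (fineUp_anti (by omega) x)) h2
        · rw [pow_succ', val_append]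
          exact dmul_tau_subset hR hc _ _ ⟨_, hj₁ j hj₁' x hx, _, h3, rfl, hle_refl hR _⟩
  let G : Language R → Prop := fun Λ => ∃ i, ∀ l : List (List A), (∀ x ∈ l, x ∈ L) →
    l.map φ ∈ Λ → IsLevel C α ρ S i l.flatten
  have hG : IsRatClosed G := by
    refine ⟨?_, ⟨1, ?_⟩, fun v => ⟨j, ?_⟩, ?_, ?_⟩
    · rintro K Λ hK ⟨i, hi⟩
      exact ⟨i, fun l hl hlK => hi l hl (hK hlK)⟩
    · intro l hl hlΛ
      have : l = [] := List.map_eq_nil_iff.1 hlΛ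
      subst this
      exact isLevel_nil hS
    · intro l hl hlΛ
      obtain ⟨x, rfl, -⟩ := List.map_eq_singleton_iff.1 (show l.map φ = [v] from hlΛ)
      have := (hj₀ x (le_factors L (hl x List.mem_cons_self))).of_le hS hj₀'
      simpa using this
    · rintro K Λ ⟨i, hi⟩ ⟨i', hi'⟩
      refine ⟨max i i', ?_⟩
      rintro l hl (h | h)
      · exact (hi l hl h).of_le hS (le_max_left _ _)
      · exact (hi' l hl h).of_le hS (le_max_right _ _)
    · rintro K Λ ⟨i, hi⟩ ⟨i', hi'⟩
      refine ⟨max i i' + 1, ?_⟩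
      intro l hl h
      obtain ⟨u, hu, v, hv, huv⟩ := Language.mem_mul.1 h
      obtain ⟨l₁, l₂, rfl, rfl, rfl⟩ := List.map_eq_append_iff.1 huv.symm
      rw [List.flatten_append]
      exact ((hi l₁ (fun x hx => hl x (by simp [hx])) hu).of_le hS (le_max_left _ _)).append hS hc
        ((hi' l₂ (fun x hx => hl x (by simp [hx])) hv).of_le hS (le_max_right _ _))
  have htop : G ⊤ := by
    refine ratClosed_top_of_bracket hG ?_
    intro g l l' hg hl hl'
    obtain ⟨i₁, hi₁⟩ := hG.singleton (l ++ l')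
    let i₂ := j + l.length + l'.length
    refine ⟨max i₁ (i₂ + 2), ?_⟩
    rintro t ht ⟨m, hm⟩
    obtain ⟨t', ty, rfl, ht', hty⟩ := List.map_eq_append_iff.1 hm
    obtain ⟨tx, tm, rfl, htx, htm⟩ := List.map_eq_append_iff.1 ht'
    by_cases hm0 : tm = []
    · subst hm0
      refine (hi₁ _ ht ?_).of_le hS (le_max_left _ _)
      change List.map _ _ = _
      simp [htx, hty]
    have hLx : ∀ x ∈ tx, x ∈ L := fun x hx => ht x (by simp [hx])
    have hLm : ∀ x ∈ tm, x ∈ L := fun x hx => ht x (by simp [hx])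
    have hLy : ∀ x ∈ ty, x ∈ L := fun x hx => ht x (by simp [hx])
    have hx0 : tx ≠ [] := by
      rintro rfl
      exact ne_nil_of_sprod_eq_coe hl htx.symm
    obtain ⟨⟨K, hK⟩, hx1, hx2⟩ := hval tx hLx g (by rw [htx, hl])
    obtain ⟨-, hy1, -⟩ := hval ty hLy g (by rw [hty, hl'])
    rw [(hflat tx hLx hx0).1] at hx2
    have hxlen : tx.length = l.length := by rw [← htx, List.length_map]
    have hylen : ty.length = l'.length := by rw [← hty, List.length_map]
    -- A fixed power of L is a finite product, so its factors are already at a bounded level; the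
    -- star itself is not known to be.
    let F := factors (L ^ tx.length)
    have hFS : tau c α ρ F ⊆ S := by
      obtain ⟨i, hi⟩ := hpow tx.length
      exact tau_subset_of_isLevel hS hi
    -- The left block realizes (e, g) through words of the same power of L. These are equivalent at
    -- level k to the middle, hence to y, so (e, g) lies in the nested set attached to y.
    have hsum : ∀ y, eqv c k tm.flatten y → (e, g * (ρ {y} + ρ {[]}) * g) ∈ S := by
      intro y hy
      refine hS.pbpol_closure _ _ e g (hk y F (isFactorClosed_factors _) hFS) ?_ hee hg
      intro i
      obtain ⟨z, hz, hzs, hzr⟩ := hx2 i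
      refine ⟨z, ⟨le_factors _ hz, ?_⟩, hzs, hzr⟩
      obtain ⟨lz, rfl, hlen, hlz⟩ := Language.mem_pow.1 hz
      have hz0 : lz ≠ [] := by
        rintro rfl
        exact hx0 (List.length_eq_zero_iff.1 hlen.symm)
      have h1 := (hflat lz hlz hz0).2
      have h2 := (hflat tm hLm hm0).2
      exact pre_trans hy.2 (pre_trans h2.1 h1.2)
    let Z : Language A := {y | eqv c k tm.flatten y}
    have hZ : (e, g * ρ Z * g + g) ∈ S := by
      obtain ⟨lz, hlz, hρZ⟩ := hnice Z
      rw [hρZ]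
      refine mem_of_sum hR hS hee hg (by rw [hK, map_mul_map_nil]) (hFS (tau_mono (le_factors _) hx2))
        _ ?_
      intro r hr
      obtain ⟨y, hy, rfl⟩ := List.mem_map.1 hr
      exact hsum y (hlz y hy)
    refine IsLevel.of_le hS (le_max_right _ _) ?_
    change (val α _, _) ∈ S
    rw [(hflat _ ht (by simp [hx0])).1]
    refine hS.downset _ _ _ hZ (hle_trans ?_ (hle_add_left hR _ _))
    rw [List.flatten_append, List.flatten_append]
    refine hle_trans (map_hle_map ρ (fineUp_append_le hc _ _ _)) ?_
    rw [map_mul]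
    refine hle_mul hR ?_ (hle_trans (map_hle_map ρ (fineUp_anti (by omega) _)) hy1)
    refine hle_trans (map_hle_map ρ (fineUp_append_le hc _ _ _)) ?_
    rw [map_mul]
    refine hle_mul hR (hle_trans (map_hle_map ρ (fineUp_anti (by omega) _)) hx1)
      (map_hle_map ρ ?_)
    intro y hy
    exact eqv_of_le (by omega) (eqv_of_fine hy)
  obtain ⟨i, hi⟩ := htop
  refine ⟨i, ?_⟩
  intro x hx
  obtain ⟨l, rfl, hl⟩ := Language.mem_kstar.1 hx
  exact hi l hl trivial

/-- Completeness: every saturated set contains the optimal pointed imprint. -/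
theorem tau_subset_of_isSaturatedPair [Finite A] [Finite M] [Finite R] (hR : ∀ r : R, r + r = r)
    (hC : IsQuotientingBooleanAlgebra C) (hfin : C.Finite) (hα : IsMorphismTypeMap C α tM)
    (hnice : IsNice ρ) (hρ : IsRatingTypeMap C ρ tR) (hS : IsSaturatedPair α tM ρ tR S 𝒯) :
    tau (canonicalSetoid C) α ρ ⊤ ⊆ S := by
  have hc := isCong_canonicalSetoid hC
  have := finite_quotient_canonicalSetoid hfin
  -- Uniformity in F matters here: k determines the congruence, before the languages F of the star
  -- case are known.
  obtain ⟨k, hk⟩ := exists_isNestedLevel hR hS hc hα hρ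
  have := finite_quotient_valEqv (α := α) (canonicalSetoid C) k
  have hG := isRatClosed_isLevel (C := C) hS hc
  obtain ⟨j, hj⟩ := ratClosed_top (isCong_valEqv (α := α) hc k) hG (by
    intro L hL h1 h2
    by_cases hne : ∃ x, x ∈ L
    swap
    · refine hG.mono ?_ hG.one
      intro x hx
      refine kstar_induction (p := fun x => x ∈ (1 : Language A)) rfl ?_ hx
      intro y hy
      exact (hne ⟨y, hy⟩).elim
    obtain ⟨x₀, hx₀⟩ := hne
    obtain ⟨i, hi⟩ := exists_isLevel_kstar hR hS hc hnice hk (fun x hx => h1 x hx x₀ hx₀)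
      (h2 x₀ hx₀) hL
    obtain ⟨j, hj⟩ := hL
    let n := max (max i j) 1
    have hF : ∀ x ∈ 1 + factors L, IsLevel C α ρ S n x := by
      rintro x (hx | hx)
      · have hx : x = [] := hx
        rw [hx]
        exact (isLevel_nil hS).of_le hS (le_max_right _ _)
      · exact (hj x hx).of_le hS (le_trans (le_max_right _ _) (le_max_left _ _))
    -- A factor of a word of L∗ is a word of L∗ flanked by two words, each empty or a factor of L;
    -- the two concatenations cost two levels.
    refine ⟨n + 2, ?_⟩
    intro y hy
    obtain ⟨y₁, h₁, z, hz, rfl⟩ := Language.mem_mul.1 (factors_kstar_le L hy)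
    obtain ⟨y₂, h₂, y₃, h₃, rfl⟩ := Language.mem_mul.1 hz
    exact ((hF y₁ h₁).of_le hS (Nat.le_succ n)).append hS hc
      (((hi y₂ h₂).of_le hS (le_trans (le_max_left _ _) (le_max_left _ _))).append hS hc
        (hF y₃ h₃)))
  exact tau_subset_of_isLevel hS fun x _ => hj x (le_factors ⊤ trivial)

end

/-! ### The fixpoint procedure -/

section

variable {A : Type u} {M : Type v} {R : Type w} [Monoid M] [NonUnitalSemiring R]
  {C : Set (Language A)} {α : FreeMonoid A →* M} {tM : M → CType C} {ρ : Language A →ₙ+* R}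
  {tR : R → CType C}

theorem le_saturationStep (P : Set (M × R) × Set (R × Set (M × R))) :
    P ≤ saturationStep tM ρ tR P :=
  ⟨fun _ hp => Or.inl (Or.inl (Or.inl hp)), fun _ hp => Or.inl (Or.inl (Or.inl hp))⟩

theorem saturationIterate_succ (n : ℕ) : saturationIterate α tM ρ tR (n + 1) =
    saturationStep tM ρ tR (saturationIterate α tM ρ tR n) :=
  Function.iterate_succ_apply' _ _ _

theorem saturationIterate_le {P : Set (M × R) × Set (R × Set (M × R))}
    (hP : IsSaturatedPair α tM ρ tR P.1 P.2) (n : ℕ) : saturationIterate α tM ρ tR n ≤ P := by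
  induction n with
  | zero => exact ⟨hP.trivial_subset, hP.nested_trivial_subset⟩
  | succ n ih =>
    rw [saturationIterate_succ]
    obtain ⟨ih₁, ih₂⟩ := ih
    constructor
    · rintro p (((hp | ⟨r, hr, hle⟩) | ⟨p₁, h₁, p₂, h₂, rfl⟩) | ⟨q, hq, e, f, hef, he, hf, rfl⟩)
      · exact ih₁ hp
      · exact hP.downset _ _ _ (ih₁ hr) hle
      · exact hP.mul _ _ _ _ (ih₁ h₁) (ih₁ h₂)
      · exact hP.pbpol_closure _ _ _ _ (ih₂ hq) hef he hf
    · rintro q (((hq | ⟨T, hT, hle⟩) | ⟨q₁, h₁, q₂, h₂, rfl⟩) | ⟨f, E, hfE, hf, hE, rfl⟩)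
      · exact ih₂ hq
      · exact hP.nested_downset _ _ _ (ih₂ hT) hle
      · exact hP.nested_mul _ _ _ _ (ih₂ h₁) (ih₂ h₂)
      -- The round uses the current first component, which may be smaller than that of P; closure
      -- under subsets absorbs the difference.
      · refine hP.nested_downset _ _ _ (hP.nested_closure _ _ (ih₂ hfE) hf hE) ?_
        exact dmul_mono (dmul_mono subset_rfl fun p hp => ⟨ih₁ hp.1, hp.2⟩) subset_rfl

theorem saturationIterate_mono : Monotone (saturationIterate α tM ρ tR) :=
  monotone_nat_of_le_succ fun n => by
    rw [saturationIterate_succ]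
    exact le_saturationStep _

theorem isSaturatedPair_of_step_eq {n : ℕ}
    (h : saturationIterate α tM ρ tR (n + 1) = saturationIterate α tM ρ tR n) :
    IsSaturatedPair α tM ρ tR (saturationIterate α tM ρ tR n).1
      (saturationIterate α tM ρ tR n).2 := by
  rw [saturationIterate_succ] at h
  have h0 : saturationIterate α tM ρ tR 0 ≤ saturationIterate α tM ρ tR n :=
    saturationIterate_mono (Nat.zero_le n)
  set P := saturationIterate α tM ρ tR n
  have h₁ : (saturationStep tM ρ tR P).1 ⊆ P.1 := by rw [h]
  have h₂ : (saturationStep tM ρ tR P).2 ⊆ P.2 := by rw [h]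
  refine ⟨h0.1, ?_, ?_, ?_, h0.2, ?_, ?_, ?_⟩
  · exact fun s r r' hr hle => h₁ (Or.inl (Or.inl (Or.inr ⟨r, hr, hle⟩)))
  · exact fun s₁ r₁ s₂ r₂ hp hq => h₁ (Or.inl (Or.inr ⟨_, hp, _, hq, rfl⟩))
  · exact fun r T e f hT hef he hf => h₁ (Or.inr ⟨_, hT, e, f, hef, he, hf, rfl⟩)
  · exact fun r T T' hT hle => h₂ (Or.inl (Or.inl (Or.inr ⟨T, hT, hle⟩)))
  · exact fun r₁ T₁ r₂ T₂ hp hq => h₂ (Or.inl (Or.inr ⟨_, hp, _, hq, rfl⟩))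
  · exact fun f E hfE hf hE => h₂ (Or.inr ⟨f, E, hfE, hf, hE, rfl⟩)

theorem exists_isLeast_saturationIterate [Finite M] [Finite R] (α : FreeMonoid A →* M)
    (tM : M → CType C) (ρ : Language A →ₙ+* R) (tR : R → CType C) :
    ∃ n, IsLeast {P : Set (M × R) × Set (R × Set (M × R)) | IsSaturatedPair α tM ρ tR P.1 P.2}
      (saturationIterate α tM ρ tR n) := by
  -- M × R is finite, so the increasing chain of rounds becomes stationary, and a stationary pair is
  -- saturated.
  obtain ⟨n, hn⟩ := WellFoundedGT.monotone_chain_condition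
    (⟨saturationIterate α tM ρ tR, saturationIterate_mono⟩ :
      ℕ →o Set (M × R) × Set (R × Set (M × R)))
  exact ⟨n, isSaturatedPair_of_step_eq (hn (n + 1) (Nat.le_succ n)).symm,
    fun P hP => saturationIterate_le hP n⟩

end

end PBPol

theorem mainTheorem2 {A M R : Type*} [Finite A] [Monoid M] [Finite M]
    [NonUnitalSemiring R] [Finite R] (hR : ∀ r : R, r + r = r)
    (C : Set (Language A)) (hC : PBPol.IsQuotientingBooleanAlgebra C) (hCfin : C.Finite)
    (α : FreeMonoid A →* M) (tM : M → PBPol.CType C) (hα : PBPol.IsMorphismTypeMap C α tM)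
    (ρ : Language A →ₙ+* R) (hnice : PBPol.IsNice ρ)
    (tR : R → PBPol.CType C) (hρ : PBPol.IsRatingTypeMap C ρ tR) :
    IsLeast {S : Set (M × R) | PBPol.IsSaturated α tM ρ tR S}
        (PBPol.pointedOptImprint (PBPol.PBPolClosure C) α ρ) ∧
      ∃ n : ℕ,
        IsLeast {P : Set (M × R) × Set (R × Set (M × R)) |
            PBPol.IsSaturatedPair α tM ρ tR P.1 P.2}
          (PBPol.saturationIterate α tM ρ tR n) ∧
        (PBPol.saturationIterate α tM ρ tR n).1 =
          PBPol.pointedOptImprint (PBPol.PBPolClosure C) α ρ := by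
  rw [PBPol.pointedOptImprint_eq_tau hC hCfin]
  have hsound := PBPol.isSaturatedPair_tau hR (PBPol.isCong_canonicalSetoid hC) hα hρ
  obtain ⟨n, hn⟩ := PBPol.exists_isLeast_saturationIterate α tM ρ tR
  refine ⟨⟨⟨_, hsound⟩, ?_⟩, n, hn, ?_⟩
  · rintro S ⟨𝒯, hS⟩
    exact PBPol.tau_subset_of_isSaturatedPair hR hC hCfin hα hnice hρ hS
  · refine Set.Subset.antisymm ?_ ?_
    · have hle := hn.2 (show (_, PBPol.nestedTau (PBPol.canonicalSetoid C) α ρ) ∈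
        {P : Set (M × R) × Set (R × Set (M × R)) | PBPol.IsSaturatedPair α tM ρ tR P.1 P.2}
        from hsound)
      exact hle.1
    · exact PBPol.tau_subset_of_isSaturatedPair hR hC hCfin hα hnice hρ hn.1
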